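/- Let $k$ be a field and let $S = k[x_{1,0},x_{1,1},x_{2,0},x_{2,1}]$ be the Cox ring of $\mathbb{P}^1\times\mathbb{P}^1$ over $k$, with the $\mathbb{Z}^2$-grading $\deg(x_{i,j}) = \mathbf{e}_i$ and irrelevant ideal $B = \langle x_{1,0},x_{1,1}\rangle \cap \langle x_{2,0},x_{2,1}\rangle$. Let $Z \subset \mathbb{P}^1\times\mathbb{P}^1$ be a zero-dimensional closed subscheme and let $I \subseteq S$ be the corresponding $B$-saturated ideal, that is, the ideal generated by all bihomogeneous forms that vanish on $Z$ scheme-theoretically. Then there exists a bihomogeneous ideal $Q \subseteq S$ with radical $\langle x_{1,0},x_{1,1}\rangle$ such that (i) the algebra $S/(I\cap Q)$ is Cohen–Macaulay, and (ii) for some $m \in \mathbb{N}$ there exists an $(m+1)\times m$ matrix over $S$ whose maximal minors generate $I\cap Q$. -/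

import Mathlib

open CategoryTheory CategoryTheory.Limits AlgebraicGeometry

universe u

noncomputable section

/-! ### The projective line and the product of two projective lines over a field -/

/-- The standard grading of `k[x₀, x₁]`. -/
abbrev lineGrading (k : Type u) [Field k] : ℕ → Submodule k (MvPolynomial (Fin 2) k) :=
  MvPolynomial.homogeneousSubmodule (Fin 2) k

instance lineGradedAlgebra (k : Type u) [Field k] : GradedAlgebra (lineGrading k) :=
  MvPolynomial.gradedAlgebra

/-- The projective line `ℙ¹ = Proj k[x₀, x₁]`. -/
abbrev projLine (k : Type u) [Field k] : Scheme.{u} := Proj (lineGrading k)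

/-- The structure morphism `ℙ¹ ⟶ Spec k`. -/
def projLineStr (k : Type u) [Field k] : projLine k ⟶ Spec (.of k) :=
  Proj.toSpecZero (lineGrading k) ≫
    Spec.map (CommRingCat.ofHom (algebraMap k (lineGrading k 0)))

/-- The standard affine open `D₊(x_c)` of `ℙ¹`. -/
abbrev projLineOpen (k : Type u) [Field k] (c : Fin 2) : (projLine k).Opens :=
  Proj.basicOpen (lineGrading k) (MvPolynomial.X c)

lemma X_mem_lineGrading (k : Type u) [Field k] (l : Fin 2) :
    (MvPolynomial.X l : MvPolynomial (Fin 2) k) ∈ lineGrading k 1 :=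
  (MvPolynomial.mem_homogeneousSubmodule 1 _).2 (MvPolynomial.isHomogeneous_X k l)

/-- The regular function `x_l / x_c` on `D₊(x_c) ⊆ ℙ¹`. -/
def projLineCoord (k : Type u) [Field k] (c l : Fin 2) : Γ(projLine k, projLineOpen k c) :=
  (Proj.awayToSection (lineGrading k) (MvPolynomial.X c)).hom
    (HomogeneousLocalization.Away.mk (lineGrading k) (X_mem_lineGrading k c) 1
      (MvPolynomial.X l) ((one_smul ℕ 1).symm ▸ X_mem_lineGrading k l))

/-- The product `ℙ¹ × ℙ¹` over `Spec k`. -/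
def biProj (k : Type u) [Field k] : Scheme.{u} := pullback (projLineStr k) (projLineStr k)

/-- The projection of `ℙ¹ × ℙ¹` to its `i`-th factor. -/
def biProjPr (k : Type u) [Field k] (i : Fin 2) : biProj k ⟶ projLine k :=
  match i with
  | 0 => pullback.fst (projLineStr k) (projLineStr k)
  | 1 => pullback.snd (projLineStr k) (projLineStr k)

/-- The structure morphism `ℙ¹ × ℙ¹ ⟶ Spec k`. -/
def biProjStr (k : Type u) [Field k] : biProj k ⟶ Spec (.of k) :=
  biProjPr k 0 ≫ projLineStr k

/-- The standard affine open `D₊(x_{0, c 0}) × D₊(x_{1, c 1})` of `ℙ¹ × ℙ¹`. -/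
def biProjOpen (k : Type u) [Field k] (c : Fin 2 → Fin 2) : (biProj k).Opens :=
  biProjPr k 0 ⁻¹ᵁ projLineOpen k (c 0) ⊓ biProjPr k 1 ⁻¹ᵁ projLineOpen k (c 1)

lemma biProjOpen_le (k : Type u) [Field k] (c : Fin 2 → Fin 2) (i : Fin 2) :
    biProjOpen k c ≤ biProjPr k i ⁻¹ᵁ projLineOpen k (c i) := by
  fin_cases i
  · exact inf_le_left
  · exact inf_le_right

/-- The regular function `x_{i, l} / x_{i, c i}` on the standard affine open with index `c`. -/
def biProjCoord (k : Type u) [Field k] (c : Fin 2 → Fin 2) (i l : Fin 2) :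
    Γ(biProj k, biProjOpen k c) :=
  ((biProj k).presheaf.map (homOfLE (biProjOpen_le k c i)).op).hom
    (((biProjPr k i).app (projLineOpen k (c i))).hom (projLineCoord k (c i) l))

/-- The inclusion of the constants `k` into the regular functions on a standard affine open. -/
def biProjConst (k : Type u) [Field k] (c : Fin 2 → Fin 2) :
    k →+* Γ(biProj k, biProjOpen k c) :=
  ((Scheme.ΓSpecIso (.of k)).inv ≫ (biProjStr k).appTop ≫
    (biProj k).presheaf.map (homOfLE le_top).op).hom

/-! ### The Cox ring and the homogeneous ideal of a closed subscheme -/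

/-- The Cox ring `S` of `ℙ¹ × ℙ¹`; the variable with index `(i, j)` is the `j`-th homogeneous
coordinate of the `i`-th factor. Factors are numbered `0, 1` here. -/
abbrev CoxRing (k : Type u) [Field k] : Type u := MvPolynomial (Fin 2 × Fin 2) k

/-- The bidegrees of the variables: `deg x_{i, j} = e_i`. -/
def coxWeight : Fin 2 × Fin 2 → (Fin 2 → ℕ) := fun v => Pi.single v.1 1

/-- The pieces of the bigrading of the Cox ring. -/
abbrev coxGrading (k : Type u) [Field k] : (Fin 2 → ℕ) → Submodule k (CoxRing k) :=
  MvPolynomial.weightedHomogeneousSubmodule k coxWeight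

instance coxGradedAlgebra (k : Type u) [Field k] : GradedAlgebra (coxGrading k) :=
  MvPolynomial.weightedGradedAlgebra k coxWeight

/-- Dehomogenization on a standard affine open: `x_{i, l} ↦ x_{i, l} / x_{i, c i}`. A form `f` of
bidegree `d` goes to the regular function `f / (x_{0, c 0} ^ d 0 * x_{1, c 1} ^ d 1)`, the
local expression of the section `f` of `𝒪(d)`. -/
def dehomogenize (k : Type u) [Field k] (c : Fin 2 → Fin 2) :
    CoxRing k →+* Γ(biProj k, biProjOpen k c) :=
  MvPolynomial.eval₂Hom (biProjConst k c) (fun v => biProjCoord k c v.1 v.2)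

/-- A form `f` vanishes on `Z` if all its local expressions restrict to zero on `Z`. -/
def VanishesOn {k : Type u} [Field k] {Z : Scheme.{u}} (ι : Z ⟶ biProj k) (f : CoxRing k) : Prop :=
  ∀ c : Fin 2 → Fin 2, (ι.app (biProjOpen k c)).hom (dehomogenize k c f) = 0

/-- The irrelevant ideal `B = ⟨x_{0,0}, x_{0,1}⟩ ∩ ⟨x_{1,0}, x_{1,1}⟩`. -/
def irrelevantIdeal (k : Type u) [Field k] : Ideal (CoxRing k) :=
  ⨅ i : Fin 2, Ideal.span {MvPolynomial.X (i, 0), MvPolynomial.X (i, 1)}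

/-- The `B`-saturated bihomogeneous ideal `I` of the Cox ring corresponding to a closed subscheme
`Z` of `ℙ¹ × ℙ¹`: it is generated by all bihomogeneous forms that vanish on `Z`,
that is, `I = ⨁_d H⁰(ℙ¹ × ℙ¹, 𝓘_Z(d))`. -/
def subschemeIdeal {k : Type u} [Field k] {Z : Scheme.{u}} (ι : Z ⟶ biProj k) :
    Ideal (CoxRing k) :=
  Ideal.span {f | SetLike.IsHomogeneousElem (coxGrading k) f ∧ VanishesOn ι f}

lemma projLineCoord_self (k : Type u) [Field k] (c : Fin 2) : projLineCoord k c c = 1 := by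
  have h : HomogeneousLocalization.Away.mk (lineGrading k) (X_mem_lineGrading k c) 1
      (MvPolynomial.X c) ((one_smul ℕ 1).symm ▸ X_mem_lineGrading k c) = 1 := by
    apply HomogeneousLocalization.val_injective
    rw [HomogeneousLocalization.Away.val_mk, HomogeneousLocalization.val_one]
    simpa using Localization.mk_self
      (⟨MvPolynomial.X c, Submonoid.mem_powers _⟩ :
        Submonoid.powers (MvPolynomial.X c : MvPolynomial (Fin 2) k))
  rw [projLineCoord, h]
  exact map_one _

lemma dehomogenize_X_self (k : Type u) [Field k] (c : Fin 2 → Fin 2) (i : Fin 2) :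
    dehomogenize k c (MvPolynomial.X (i, c i)) = 1 := by
  simp [dehomogenize, biProjCoord, projLineCoord_self]

/-- The ideal of a closed subscheme is `B`-saturated: `(I : B ^ n) = I` for all `n`. -/
theorem subschemeIdeal_saturated {k : Type u} [Field k] {Z : Scheme.{u}} (ι : Z ⟶ biProj k)
    (n : ℕ) (f : CoxRing k) (hf : ∀ b ∈ irrelevantIdeal k ^ n, f * b ∈ subschemeIdeal ι) :
    f ∈ subschemeIdeal ι := by
  classical
  have hom : (subschemeIdeal ι).IsHomogeneous (coxGrading k) :=
    Ideal.homogeneous_span _ _ fun x hx => hx.1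
  have van : ∀ g ∈ subschemeIdeal ι, VanishesOn ι g := by
    intro g hg c
    have hle : subschemeIdeal ι ≤
        RingHom.ker ((ι.app (biProjOpen k c)).hom.comp (dehomogenize k c)) :=
      Ideal.span_le.2 fun x hx => hx.2 c
    exact hle hg
  rw [← DirectSum.sum_support_decompose (coxGrading k) f]
  refine Ideal.sum_mem _ fun d _ => Ideal.subset_span ⟨⟨d, SetLike.coe_mem _⟩, fun c => ?_⟩
  have hb : (MvPolynomial.X (0, c 0) * MvPolynomial.X (1, c 1) : CoxRing k) ∈
      irrelevantIdeal k := by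
    have hX : ∀ i : Fin 2, (MvPolynomial.X (i, c i) : CoxRing k) ∈
        Ideal.span {MvPolynomial.X (i, 0), MvPolynomial.X (i, 1)} := by
      intro i
      apply Ideal.subset_span
      rcases Fin.exists_fin_two.1 ⟨c i, rfl⟩ with h | h <;> simp [h]
    rw [irrelevantIdeal, Ideal.mem_iInf]
    intro i
    fin_cases i
    · exact Ideal.mul_mem_right _ _ (hX 0)
    · exact Ideal.mul_mem_left _ _ (hX 1)
  have hX : ∀ i : Fin 2, (MvPolynomial.X (i, c i) : CoxRing k) ∈
      coxGrading k (Pi.single i 1) := fun i =>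
    MvPolynomial.isWeightedHomogeneous_X k coxWeight (i, c i)
  have hbd := SetLike.pow_mem_graded n (SetLike.mul_mem_graded (hX 0) (hX 1))
  have h1 := hom (d + n • (Pi.single 0 1 + Pi.single 1 1)) (hf _ (Ideal.pow_mem_pow hb n))
  rw [DirectSum.coe_decompose_mul_add_of_right_mem (coxGrading k) hbd] at h1
  have h2 := van _ h1 c
  simpa [dehomogenize_X_self] using h2

/-! ### Cohen–Macaulay rings and maximal minors -/

/-- A (Noetherian) local ring is Cohen–Macaulay if its depth is its Krull dimension, that is,
its maximal ideal contains a regular sequence whose length is the Krull dimension. -/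
def IsCohenMacaulayLocal (R : Type u) [CommRing R] [IsLocalRing R] : Prop :=
  ∃ rs : List R, (∀ r ∈ rs, r ∈ IsLocalRing.maximalIdeal R) ∧
    RingTheory.Sequence.IsRegular R rs ∧ (rs.length : WithBot ℕ∞) = ringKrullDim R

/-- A ring is Cohen–Macaulay if it is Noetherian and its localizations at all maximal ideals
are Cohen–Macaulay local rings. -/
def IsCohenMacaulay (R : Type u) [CommRing R] : Prop :=
  IsNoetherianRing R ∧
    ∀ (P : Ideal R) [P.IsMaximal], IsCohenMacaulayLocal (Localization.AtPrime P)

/-- The ideal generated by the maximal minors of an `(m + 1) × m` matrix: the `i`-th one is the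
determinant of the square matrix that is left when the `i`-th row is deleted. -/
def maximalMinorsIdeal {R : Type u} [CommRing R] {m : ℕ}
    (A : Matrix (Fin (m + 1)) (Fin m) R) : Ideal R :=
  Ideal.span (Set.range fun i : Fin (m + 1) => (A.submatrix i.succAbove id).det)

end

noncomputable section

/-! ### The Hilbert–Burch complex -/

section HilbertBurch

open Matrix

/-! Take `Q = ⟨x₀, x₁⟩ⁿ⁺¹` for large `n`, where `x` are the coordinates of the first factor and `y`
those of the second. Over `A = k[y₀, y₁]`, the ideal `I` splits into modules `I_m` of forms of
`x`-degree `m`, and `I ∩ Q` is its truncation to degrees at least `n + 1`.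

Saturation in `y` makes each `I_m` free over `A` (`free_of_saturated`). Zero-dimensionality puts
nonzero forms `F(x)` and `G(y)` into `I` (`exists_rename_mem_subschemeIdeal`); by `G`, the rank of
`I_m` is `m + 1`. For large `n`, a basis `f` of `I_{n+1}` generates `I ∩ Q`. With a basis `h` of
`I_n`, the identities `x₁(x₀h_j) = x₀(x₁h_j)` give an `(n+2) × (n+1)` matrix of linear syzygies of
`f`.

This matrix is injective, also modulo each prime of `A`, because `I` is saturated in `x`
(`exists_eq_C_smul_of_syzygyMatrix_mulVec`). Its minors are therefore proportional to `f`; comparing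
degrees and prime factors shows that the ratio is a unit (`exists_isUnit_signedMinor_syzygyMatrix`).

By `F` and `G`, the minors have no common prime factor. So the Hilbert–Burch complex is exact and
the quotient has depth at least two at every maximal ideal, while its dimension is at most two: it
is Cohen–Macaulay (`isCohenMacaulay_quotient_maximalMinorsIdeal`). -/

lemma dvd_of_forall_dvd_mul_of_no_common_prime {R : Type*} [CommRing R] [IsDomain R]
    [UniqueFactorizationMonoid R] {ι : Type*} {d : ι → R}
    (hd : ∀ p : R, Prime p → ∃ i, ¬ p ∣ d i) {y : R} (hy : y ≠ 0) {x : R}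
    (h : ∀ i, y ∣ x * d i) : y ∣ x := by
  induction y using UniqueFactorizationMonoid.induction_on_prime generalizing x with
  | h₁ => exact absurd rfl hy
  | h₂ y hu => exact hu.dvd
  | h₃ y p _ hp ih =>
    obtain ⟨i, hi⟩ := hd p hp
    obtain ⟨x', rfl⟩ : p ∣ x :=
      (hp.dvd_or_dvd ((Dvd.intro _ rfl).trans (h i))).resolve_right hi
    refine mul_dvd_mul_left p (ih (right_ne_zero_of_mul hy) fun i => ?_)
    have := h i
    rw [mul_assoc] at this
    exact (mul_dvd_mul_iff_left hp.ne_zero).1 this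

variable {R : Type*} [CommRing R] {n : ℕ}

/-- The maximal minors of an `(n + 1) × n` matrix, with the signs of the Laplace expansion. -/
def signedMinor (M : Matrix (Fin (n + 1)) (Fin n) R) (i : Fin (n + 1)) : R :=
  (-1) ^ (i : ℕ) * (M.submatrix i.succAbove id).det

lemma signedMinor_ne_zero_iff (M : Matrix (Fin (n + 1)) (Fin n) R) (i : Fin (n + 1)) :
    signedMinor M i ≠ 0 ↔ (M.submatrix i.succAbove id).det ≠ 0 := by
  rw [signedMinor, Ne, (isUnit_one.neg.pow _).mul_right_eq_zero]

lemma span_range_signedMinor (M : Matrix (Fin (n + 1)) (Fin n) R) :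
    Ideal.span (Set.range (signedMinor M)) = maximalMinorsIdeal M := by
  have h : ∀ i, Associated (signedMinor M i) (M.submatrix i.succAbove id).det := fun i =>
    associated_unit_mul_left _ _ (isUnit_one.neg.pow _)
  apply le_antisymm <;> rw [maximalMinorsIdeal, Ideal.span_le] <;> rintro _ ⟨i, rfl⟩
  · exact Ideal.mem_of_dvd _ (h i).symm.dvd (Ideal.subset_span ⟨i, rfl⟩)
  · exact Ideal.mem_of_dvd _ (h i).dvd (Ideal.subset_span ⟨i, rfl⟩)

lemma signedMinor_vecMul (M : Matrix (Fin (n + 1)) (Fin n) R) : signedMinor M ᵥ* M = 0 := by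
  ext j
  -- Repeating column `j` in front makes the determinant vanish; its Laplace expansion along that
  -- column is the claim.
  let A : Matrix (Fin (n + 1)) (Fin (n + 1)) R := Matrix.of fun i => Fin.cons (M i j) (M i)
  have hA : A.det = 0 := det_zero_of_column_eq (Fin.succ_ne_zero j).symm fun i => by simp [A]
  rw [det_succ_column_zero] at hA
  rw [vecMul, dotProduct, Pi.zero_apply, ← hA]
  refine Finset.sum_congr rfl fun i _ => ?_
  have : A.submatrix i.succAbove Fin.succ = M.submatrix i.succAbove id := by
    ext a b; simp [A]
  rw [this, signedMinor]
  simp only [A, of_apply, Fin.cons_zero]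
  ring

lemma sum_succAbove_eq_zero_of_vecMul_eq_zero [IsDomain R] {M : Matrix (Fin (n + 1)) (Fin n) R}
    {i : Fin (n + 1)} (hi : signedMinor M i ≠ 0) {g : Fin (n + 1) → R} (hg : g ᵥ* M = 0)
    (hgi : g i = 0) : g = 0 := by
  have h0 : (fun a => g (i.succAbove a)) ᵥ* M.submatrix i.succAbove id = 0 := by
    ext j
    have := congrFun hg j
    simp only [vecMul, dotProduct, Fin.sum_univ_succAbove _ i, hgi, zero_mul, zero_add] at this
    simpa [vecMul, dotProduct] using this
  have h1 := eq_zero_of_vecMul_eq_zero ((signedMinor_ne_zero_iff M i).1 hi) h0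
  ext a
  rcases Fin.eq_self_or_eq_succAbove i a with rfl | ⟨b, rfl⟩
  · exact hgi
  · exact congrFun h1 b

/-- The left kernel has rank one, since a vector in it is determined by the entry at a row whose
deletion leaves a nonzero minor. It also contains the signed minors. -/
lemma signedMinor_mul_eq [IsDomain R] {M : Matrix (Fin (n + 1)) (Fin n) R}
    {i : Fin (n + 1)} (hi : signedMinor M i ≠ 0) {f : Fin (n + 1) → R} (hf : f ᵥ* M = 0)
    (j : Fin (n + 1)) : signedMinor M i * f j = f i * signedMinor M j := by
  have := sum_succAbove_eq_zero_of_vecMul_eq_zero hi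
    (g := signedMinor M i • f - f i • signedMinor M)
    (by rw [sub_vecMul, smul_vecMul, smul_vecMul, hf, signedMinor_vecMul]; simp)
    (by simp [mul_comm])
  exact sub_eq_zero.1 (congrFun this j)

lemma mulVec_injective_of_signedMinor_ne_zero [IsDomain R] {M : Matrix (Fin (n + 1)) (Fin n) R}
    {i : Fin (n + 1)} (hi : signedMinor M i ≠ 0) : Function.Injective M.mulVec := by
  refine (injective_iff_map_eq_zero (Matrix.mulVecLin M)).2 fun v hv => ?_
  refine eq_zero_of_mulVec_eq_zero ((signedMinor_ne_zero_iff M i).1 hi) ?_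
  ext a
  exact congrFun hv (i.succAbove a)

/-- Cramer's rule on the rows other than `i`. Row `i` then agrees too, because both sides are
orthogonal to the signed minors and the `i`-th of these is nonzero. -/
lemma exists_mulVec_eq_signedMinor_smul [IsDomain R] {M : Matrix (Fin (n + 1)) (Fin n) R}
    {w : Fin (n + 1) → R} (hw : signedMinor M ⬝ᵥ w = 0) (i : Fin (n + 1)) :
    ∃ v, M *ᵥ v = signedMinor M i • w := by
  by_cases hi : signedMinor M i = 0
  · exact ⟨0, by simp [hi]⟩
  let N := M.submatrix i.succAbove id
  let v : Fin n → R := (-1) ^ (i : ℕ) • (N.adjugate *ᵥ fun a => w (i.succAbove a))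
  have hv : ∀ a, (M *ᵥ v) (i.succAbove a) = signedMinor M i * w (i.succAbove a) := by
    intro a
    have : (N *ᵥ v) a = signedMinor M i * w (i.succAbove a) := by
      simp only [v, mulVec_smul, mulVec_mulVec, mul_adjugate, smul_mulVec, one_mulVec]
      simp [signedMinor, N, mul_assoc]
    exact this
  refine ⟨v, ?_⟩
  have h0 : signedMinor M ⬝ᵥ (M *ᵥ v - signedMinor M i • w) = 0 := by
    rw [dotProduct_sub, dotProduct_mulVec, signedMinor_vecMul, zero_dotProduct, dotProduct_smul, hw]
    simp
  rw [dotProduct, Fin.sum_univ_succAbove _ i] at h0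
  simp only [Pi.sub_apply, hv, Pi.smul_apply, smul_eq_mul, sub_self, mul_zero,
    Finset.sum_const_zero, add_zero] at h0
  ext a
  rcases Fin.eq_self_or_eq_succAbove i a with rfl | ⟨b, rfl⟩
  · exact sub_eq_zero.1 ((mul_eq_zero.1 h0).resolve_left hi)
  · exact hv b

/-- Exactness of the Hilbert–Burch complex. -/
lemma exists_mulVec_eq_of_signedMinor_dotProduct_eq_zero [IsDomain R]
    [UniqueFactorizationMonoid R] {M : Matrix (Fin (n + 1)) (Fin n) R}
    (hp : ∀ p : R, Prime p → ∃ i, ¬ p ∣ signedMinor M i) {i : Fin (n + 1)}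
    (hi : signedMinor M i ≠ 0) {w : Fin (n + 1) → R} (hw : signedMinor M ⬝ᵥ w = 0) :
    ∃ v, M *ᵥ v = w := by
  choose v hv using exists_mulVec_eq_signedMinor_smul hw
  have hinj := mulVec_injective_of_signedMinor_ne_zero hi
  -- With `Δ` the signed minors, this says `Δ_i v_j = Δ_j v_i`. So `Δ_i` divides every `Δ_j v_i`,
  -- hence `v_i`, as the `Δ_j` share no prime factor.
  have h1 : ∀ j, signedMinor M i • v j = signedMinor M j • v i := fun j => hinj <| by
    simp only [mulVec_smul, hv, smul_smul, mul_comm]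
  have h2 : ∀ a, signedMinor M i ∣ v i a := fun a =>
    dvd_of_forall_dvd_mul_of_no_common_prime hp hi fun j => by
      have := congrFun (h1 j) a
      simp only [Pi.smul_apply, smul_eq_mul] at this
      rw [mul_comm, ← this]
      exact Dvd.intro _ rfl
  choose u hu using h2
  refine ⟨u, ?_⟩
  have h3 : v i = signedMinor M i • u := funext hu
  have h4 := hv i
  rw [h3, mulVec_smul] at h4
  ext a
  exact mul_left_cancel₀ hi (congrFun h4 a)

end HilbertBurch

/-! ### Regular sequences in polynomial rings over a field -/

section RegularSequences

open RingTheory.Sequence Polynomial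

/-- The quotient of `A[X]` by a monic polynomial is free over `A`, and weakly regular sequences stay
so on flat modules. -/
lemma Polynomial.Monic.isWeaklyRegular_cons_map_C {A : Type*} [CommRing A] {p : A[X]}
    (hp : p.Monic) {rs : List A} (h : IsWeaklyRegular A rs) :
    IsWeaklyRegular A[X] (p :: rs.map (algebraMap A A[X])) := by
  refine .cons (fun a b hab => hp.isRegular.left hab) ?_
  rw [isWeaklyRegular_map_algebraMap_iff]
  have e : (QuotSMulTop p A[X]) ≃ₗ[A] (A[X] ⧸ Ideal.span {p}) :=
    (Submodule.quotEquivOfEq _ _ (by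
      rw [← Submodule.ideal_span_singleton_smul, smul_eq_mul, Ideal.mul_top])).restrictScalars A
  rw [e.isWeaklyRegular_congr]
  have := hp.free_quotient
  exact ((TensorProduct.rid A (A[X] ⧸ Ideal.span {p})).isWeaklyRegular_congr rs).1
    h.isWeaklyRegular_lTensor

/-- Every ideal with a quotient that is integral over the base ring contains a weakly regular
sequence of length `n`. -/
def HasRegularSequences (k T : Type*) [CommRing k] [CommRing T] [Algebra k T] (n : ℕ) : Prop :=
  ∀ P : Ideal T, Algebra.IsIntegral k (T ⧸ P) →
    ∃ rs : List T, rs.length = n ∧ (∀ r ∈ rs, r ∈ P) ∧ IsWeaklyRegular T rs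

lemma HasRegularSequences.of_algEquiv {k T T' : Type*} [CommRing k] [CommRing T] [Algebra k T]
    [CommRing T'] [Algebra k T'] (e : T ≃ₐ[k] T') {n : ℕ} (h : HasRegularSequences k T n) :
    HasRegularSequences k T' n := by
  intro P hP
  have : Algebra.IsIntegral k (T ⧸ P.comap e) :=
    .of_injective (Ideal.quotientMapₐ P (e : T →ₐ[k] T') le_rfl)
      (Ideal.quotientMap_injective (f := (e : T →+* T')))
  obtain ⟨rs, hl, hm, hr⟩ := h _ this
  refine ⟨rs.map e, by simpa, by simpa using hm, ?_⟩
  exact (e.toLinearEquiv.toAddEquiv.isWeaklyRegular_congr (by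
    rw [List.forall₂_map_right_iff, List.forall₂_same]
    intro r _ x
    simp)).1 hr

/-- An integral equation of `X` modulo `P` is a monic polynomial in `P`; the contraction of `P` to
`A` supplies the other terms. -/
lemma HasRegularSequences.polynomial {k A : Type*} [CommRing k] [CommRing A] [Algebra k A]
    {n : ℕ} (h : HasRegularSequences k A n) : HasRegularSequences k A[X] (n + 1) := by
  intro P hP
  have : Algebra.IsIntegral k (A ⧸ P.comap (CAlgHom : A →ₐ[A] A[X])) :=
    .of_injective (Ideal.quotientMapₐ P ((CAlgHom : A →ₐ[A] A[X]).restrictScalars k) le_rfl)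
      (Ideal.quotientMap_injective)
  obtain ⟨rs, hl, hm, hr⟩ := h _ this
  obtain ⟨q, hq, hq0⟩ := hP.isIntegral (Ideal.Quotient.mk P X)
  refine ⟨q.map (algebraMap k A) :: rs.map (algebraMap A A[X]), by simpa, ?_,
    (hq.map _).isWeaklyRegular_cons_map_C hr⟩
  simp only [List.mem_cons, List.mem_map, forall_eq_or_imp, forall_exists_index, and_imp,
    forall_apply_eq_imp_iff₂]
  refine ⟨?_, hm⟩
  rw [← Ideal.Quotient.eq_zero_iff_mem, ← hq0]
  have h1 : q.map (algebraMap k A) = aeval (X : A[X]) q := by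
    rw [aeval_X_left_eq_map]
  rw [h1, ← Ideal.Quotient.mkₐ_eq_mk k, ← aeval_algHom_apply]
  rfl

lemma MvPolynomial.hasRegularSequences (k : Type*) [Field k] (σ : Type*) [Finite σ] :
    HasRegularSequences k (MvPolynomial σ k) (Nat.card σ) := by
  induction σ using Finite.induction_empty_option with
  | of_equiv e H =>
    rw [← Nat.card_congr e]
    exact H.of_algEquiv (MvPolynomial.renameEquiv k e)
  | h_empty => exact fun P _ => ⟨[], by simp⟩
  | h_option H =>
    rw [Finite.card_option]
    exact H.polynomial.of_algEquiv (MvPolynomial.optionEquivLeft k _).symm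

lemma MvPolynomial.exists_isRegular_of_isMaximal {k : Type*} [Field k] {σ : Type*} [Finite σ]
    (P : Ideal (MvPolynomial σ k)) [hP : P.IsMaximal] :
    ∃ rs : List (MvPolynomial σ k), rs.length = Nat.card σ ∧ (∀ r ∈ rs, r ∈ P) ∧
      IsRegular (MvPolynomial σ k) rs := by
  let := Ideal.Quotient.field P
  have : Module.Finite k (MvPolynomial σ k ⧸ P) :=
    finite_of_finite_type_of_isJacobsonRing k _
  obtain ⟨rs, hl, hm, hr⟩ := MvPolynomial.hasRegularSequences k σ P inferInstance
  refine ⟨rs, hl, hm, hr, fun h => hP.ne_top ?_⟩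
  rw [smul_eq_mul, Ideal.mul_top] at h
  exact top_le_iff.1 (h ▸ Ideal.span_le.2 hm)

end RegularSequences

/-! ### Depth along the Hilbert–Burch complex -/

section Depth

open Abelian ModuleCat

variable {R : Type u} [CommRing R]

/-- In the long exact sequence, `Ext N S.X₃ i` sits between `Ext N S.X₂ i` and `Ext N S.X₁ (i + 1)`;
this is the depth lemma. -/
lemma subsingleton_ext_of_shortExact (N : ModuleCat.{u} R) {S : ShortComplex (ModuleCat.{u} R)}
    (hS : S.ShortExact) {n : ℕ} (h₁ : ∀ i < n + 1, Subsingleton (Ext N S.X₁ i))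
    (h₂ : ∀ i < n, Subsingleton (Ext N S.X₂ i)) : ∀ i < n, Subsingleton (Ext N S.X₃ i) := by
  intro i hi
  have z₁ := AddCommGrpCat.isZero_of_iff_subsingleton.mpr (h₁ (i + 1) (by omega))
  have z₂ := AddCommGrpCat.isZero_of_iff_subsingleton.mpr (h₂ i hi)
  exact AddCommGrpCat.subsingleton_of_isZero <| ShortComplex.Exact.isZero_of_both_zeros
    (Ext.covariant_sequence_exact₃' N hS i (i + 1) rfl)
    (z₂.eq_zero_of_src _) (z₁.eq_zero_of_tgt _)

/-- The identity of `Rᵐ` is a sum of maps that factor through `R`, so every class is a sum of images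
of classes in `Ext N R i`. -/
lemma subsingleton_ext_pi (N : ModuleCat.{u} R) {i : ℕ}
    (h : Subsingleton (Ext N (ModuleCat.of R R) i)) (m : ℕ) :
    Subsingleton (Ext N (ModuleCat.of R (Fin m → R)) i) := by
  let p (j : Fin m) : ModuleCat.of R (Fin m → R) ⟶ ModuleCat.of R R :=
    ModuleCat.ofHom (LinearMap.proj j)
  let q (j : Fin m) : ModuleCat.of R R ⟶ ModuleCat.of R (Fin m → R) :=
    ModuleCat.ofHom (LinearMap.single R (fun _ => R) j)
  have hid : ∑ j, p j ≫ q j = 𝟙 (ModuleCat.of R (Fin m → R)) := by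
    ext : 1
    rw [ModuleCat.hom_sum]
    refine LinearMap.ext fun x => funext fun i => ?_
    simp [p, q, Pi.single_apply]
  refine subsingleton_of_forall_eq 0 fun x => ?_
  rw [← Ext.comp_mk₀_id x, ← hid, Ext.mk₀_sum, Ext.comp_sum]
  refine Finset.sum_eq_zero fun j _ => ?_
  rw [← Ext.mk₀_comp_mk₀, ← Ext.comp_assoc_of_third_deg_zero,
    Subsingleton.elim (x.comp (Ext.mk₀ (p j)) _) 0, Ext.zero_comp]

/-- If `0 → Rᵐ → Rⁿ → R → R / J → 0` is exact and the depth of `R` along `N` is at least four,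
then the depth of `R / J` along `N` is at least two. -/
lemma subsingleton_ext_quotient (N : ModuleCat.{u} R)
    (h : ∀ i < 4, Subsingleton (Ext N (ModuleCat.of R R) i)) {m n : ℕ}
    {a : (Fin m → R) →ₗ[R] (Fin n → R)} {b : (Fin n → R) →ₗ[R] R} (ha : Function.Injective a)
    (hab : Function.Exact a b) :
    ∀ i < 2, Subsingleton (Ext N (ModuleCat.of R (R ⧸ (LinearMap.range b : Ideal R))) i) := by
  let J : Ideal R := LinearMap.range b
  let S₁ : ShortComplex (ModuleCat.{u} R) :=
    ModuleCat.shortComplexOfCompEqZero a b.rangeRestrict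
      (LinearMap.ext fun x => Subtype.ext (hab.apply_apply_eq_zero x))
  let S₂ : ShortComplex (ModuleCat.{u} R) :=
    ModuleCat.shortComplexOfCompEqZero J.subtype J.mkQ
      (LinearMap.exact_subtype_mkQ J).linearMap_comp_eq_zero
  have h₁ : S₁.ShortExact := ModuleCat.shortComplex_shortExact S₁
    (fun x => Subtype.ext_iff.trans (hab x)) ha b.surjective_rangeRestrict
  have h₂ : S₂.ShortExact := ModuleCat.shortComplex_shortExact S₂
    (LinearMap.exact_subtype_mkQ J) J.injective_subtype J.mkQ_surjective
  -- Each short exact sequence costs one degree: vanishing below 4 for the free modules, below 3 for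
  -- `J`, below 2 for `R / J`.
  refine subsingleton_ext_of_shortExact N h₂ (n := 2) ?_ fun i hi => h i (by omega)
  exact subsingleton_ext_of_shortExact N h₁
    (fun i hi => subsingleton_ext_pi N (h i hi) m)
    fun i hi => subsingleton_ext_pi N (h i (by omega)) n

end Depth

/-! ### Cohen–Macaulayness of determinantal quotients -/

section CohenMacaulay

open Matrix

/-- A chain of primes over `J` extends downwards by two steps: its least member contains a prime
element `p`, and `0 < (p)` lies strictly below it because `p` does not divide all of `J`. -/
lemma ringKrullDim_quotient_le_of_no_common_prime {R : Type*} [CommRing R] [IsDomain R]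
    [UniqueFactorizationMonoid R] {J : Ideal R} (h0 : J ≠ ⊥)
    (hJ : ∀ p : R, Prime p → ∃ x ∈ J, ¬ p ∣ x) {m : ℕ} (hm : ringKrullDim R ≤ (m + 2 : ℕ)) :
    ringKrullDim (R ⧸ J) ≤ m := by
  obtain ⟨x, hxJ, hx0⟩ := Submodule.exists_mem_ne_zero_of_ne_bot h0
  have key : ∀ l : LTSeries (PrimeSpectrum.zeroLocus (J : Set R)),
      ((l.length + 2 : ℕ) : WithBot ℕ∞) ≤ ringKrullDim R := by
    intro l
    let l' : LTSeries (PrimeSpectrum R) := l.map Subtype.val fun _ _ h => h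
    have hJl : (J : Set R) ⊆ l'.head.asIdeal := l.head.2
    obtain ⟨p, hpm, hp⟩ : ∃ p ∈ l'.head.asIdeal, Prime p := by
      obtain ⟨p, hp1, hp2⟩ := l'.head.2.exists_mem_prime_of_ne_bot
        (fun h => hx0 (by simpa [h] using hJl hxJ))
      exact ⟨p, hp1, hp2⟩
    let P : PrimeSpectrum R := ⟨Ideal.span {p}, (Ideal.span_singleton_prime hp.ne_zero).2 hp⟩
    have h1 : P < l'.head := by
      refine lt_of_le_of_ne ((Ideal.span_singleton_le_iff_mem _).2 hpm) fun h => ?_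
      obtain ⟨y, hyJ, hy⟩ := hJ p hp
      have : y ∈ P.asIdeal := h ▸ hJl hyJ
      exact hy (Ideal.mem_span_singleton.1 this)
    have h2 : (⊥ : PrimeSpectrum R) < P := by
      refine lt_of_le_of_ne bot_le fun h => hp.ne_zero ?_
      have : p ∈ (⊥ : PrimeSpectrum R).asIdeal := h ▸ Ideal.mem_span_singleton_self p
      simpa using this
    refine le_trans (le_of_eq ?_)
      (Order.LTSeries.length_le_krullDim ((l'.cons P h1).cons ⊥ h2))
    rw [show ((l'.cons P h1).cons ⊥ h2).length = l.length + 2 from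
      (RelSeries.cons_length _ _ _).trans (congrArg (· + 1) (RelSeries.cons_length _ _ _))]
  rw [ringKrullDim_quotient]
  refine iSup_le fun l => ?_
  have := (key l).trans hm
  norm_cast at this ⊢
  omega

variable {k : Type u} [Field k] {σ : Type} [Finite σ] {n : ℕ}

lemma exists_isWeaklyRegular_quotient_maximalMinorsIdeal (hσ : Nat.card σ = 4)
    {M : Matrix (Fin (n + 1)) (Fin n) (MvPolynomial σ k)}
    (hp : ∀ p, Prime p → ∃ i, ¬ p ∣ signedMinor M i) {i : Fin (n + 1)}
    (hi : signedMinor M i ≠ 0) (P : Ideal (MvPolynomial σ k)) [P.IsMaximal]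
    (hP : maximalMinorsIdeal M ≤ P) :
    ∃ rs : List (MvPolynomial σ k), rs.length = 2 ∧ (∀ r ∈ rs, r ∈ P) ∧
      RingTheory.Sequence.IsWeaklyRegular (MvPolynomial σ k ⧸ maximalMinorsIdeal M) rs := by
  let S := MvPolynomial σ k
  have hPtop : P ≠ ⊤ := Ideal.IsMaximal.ne_top ‹_›
  let N := ModuleCat.of S (S ⧸ P)
  have hN : Module.support S N = PrimeSpectrum.zeroLocus P := by
    rw [Module.support_eq_zeroLocus, Ideal.annihilator_quotient]
  obtain ⟨rs, hl, hm, hr⟩ := MvPolynomial.exists_isRegular_of_isMaximal P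
  -- Rees' criterion: the regular sequence of length four in `P` kills `Ext` from `S / P` below
  -- degree four. The converse criterion is applied to the quotient at the end.
  have h4 : ∀ i < 4, Subsingleton (Abelian.Ext N (ModuleCat.of S S) i) := by
    rw [← hσ, ← hl]
    refine ModuleCat.subsingleton_ext_of_exists_isRegular P N hN.subset (ModuleCat.of S S)
      ?_ rs hm hr
    rw [lt_top_iff_ne_top]
    simpa using hPtop
  let b : (Fin (n + 1) → S) →ₗ[S] S := dotProductBilin S S (signedMinor M)
  have hb : LinearMap.range b = maximalMinorsIdeal M := by
    rw [← span_range_signedMinor]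
    ext x
    rw [Ideal.mem_span_range_iff_exists_fun]
    refine exists_congr fun c => ?_
    rw [show b c = signedMinor M ⬝ᵥ c from rfl, dotProduct_comm]
    rfl
  have h2 := subsingleton_ext_quotient N h4 (a := M.mulVecLin) (b := b)
    (mulVec_injective_of_signedMinor_ne_zero hi) (fun w => by
      constructor
      · exact exists_mulVec_eq_of_signedMinor_dotProduct_eq_zero hp hi
      · rintro ⟨v, rfl⟩
        change signedMinor M ⬝ᵥ (M *ᵥ v) = 0
        rw [dotProduct_mulVec, signedMinor_vecMul, zero_dotProduct])
  rw [hb] at h2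
  obtain ⟨rs, hl, hm, hr⟩ := ModuleCat.exists_isRegular_of_exists_subsingleton_ext P 2
    (ModuleCat.of S (S ⧸ maximalMinorsIdeal M)) (by
      rw [lt_top_iff_ne_top]
      intro h
      have hle : P • (⊤ : Submodule S (S ⧸ maximalMinorsIdeal M)) ≤
          Submodule.map (maximalMinorsIdeal M).mkQ P := by
        refine Submodule.smul_le.2 fun r hr x _ => ?_
        obtain ⟨y, rfl⟩ := Submodule.mkQ_surjective _ x
        exact ⟨r * y, P.mul_mem_right y hr, by rw [← smul_eq_mul, map_smul]⟩
      obtain ⟨y, hy, hy1⟩ := hle (h.ge Submodule.mem_top :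
        Submodule.mkQ _ (1 : S) ∈ P • (⊤ : Submodule S (S ⧸ maximalMinorsIdeal M)))
      have := (Submodule.Quotient.eq _).1 hy1
      exact hPtop ((Ideal.eq_top_iff_one _).2 (by simpa using P.sub_mem hy (hP this)))) N hN h2
  exact ⟨rs, hl, hm, hr.1⟩

/-- The quotient of a polynomial ring in four variables by the ideal of the maximal minors of an
`(n + 1) × n` matrix is Cohen–Macaulay if these minors have no common factor. -/
theorem isCohenMacaulay_quotient_maximalMinorsIdeal (hσ : Nat.card σ = 4)
    {M : Matrix (Fin (n + 1)) (Fin n) (MvPolynomial σ k)}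
    (hp : ∀ p, Prime p → ∃ i, ¬ p ∣ signedMinor M i) {i : Fin (n + 1)}
    (hi : signedMinor M i ≠ 0) :
    IsCohenMacaulay (MvPolynomial σ k ⧸ maximalMinorsIdeal M) := by
  refine ⟨inferInstance, fun P hP => ?_⟩
  let J := maximalMinorsIdeal M
  have hJ : ∀ j, signedMinor M j ∈ J := fun j =>
    (span_range_signedMinor M).le (Ideal.subset_span ⟨j, rfl⟩)
  have hdim : ringKrullDim (MvPolynomial σ k ⧸ J) ≤ (2 : ℕ) := by
    refine ringKrullDim_quotient_le_of_no_common_prime (fun h => hi ?_) (fun p hpp => ?_) ?_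
    · rw [← Ideal.mem_bot, ← h]
      exact hJ i
    · obtain ⟨j, hj⟩ := hp p hpp
      exact ⟨_, hJ j, hj⟩
    · rw [MvPolynomial.ringKrullDim_of_isNoetherianRing, ringKrullDim_eq_zero_of_field, hσ,
        zero_add]
  have : (P.comap (Ideal.Quotient.mk J)).IsMaximal :=
    Ideal.comap_isMaximal_of_surjective _ Ideal.Quotient.mk_surjective
  obtain ⟨rs, hl, hm, hr⟩ := exists_isWeaklyRegular_quotient_maximalMinorsIdeal hσ hp hi
    (P.comap (Ideal.Quotient.mk J)) (fun x hx => by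
      rw [Ideal.mem_comap, Ideal.Quotient.eq_zero_iff_mem.2 hx]
      exact P.zero_mem)
  have hr' : RingTheory.Sequence.IsWeaklyRegular (MvPolynomial σ k ⧸ J)
      (rs.map (algebraMap _ (MvPolynomial σ k ⧸ J))) :=
    (RingTheory.Sequence.isWeaklyRegular_map_algebraMap_iff _ _ _).2 hr
  have hreg := hr'.isRegular_of_isLocalization_of_mem (Localization.AtPrime P) P
    (by simpa using! hm)
  have hmem : ∀ r ∈ (rs.map (algebraMap _ (MvPolynomial σ k ⧸ J))).map
      (algebraMap _ (Localization.AtPrime P)), r ∈ IsLocalRing.maximalIdeal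
        (Localization.AtPrime P) := by
    simp only [List.map_map, List.mem_map, forall_exists_index, and_imp,
      forall_apply_eq_imp_iff₂]
    intro r hrr
    exact (IsLocalization.AtPrime.to_map_mem_maximal_iff _ P _).2 (hm r hrr)
  -- A regular sequence of length two forces dimension at least two, which meets the upper bound
  -- coming from `hdim`.
  have h2 := ringKrullDim_add_length_eq_ringKrullDim_of_isRegular _ hreg
  have h3 : ringKrullDim (Localization.AtPrime P) ≤ (2 : ℕ) := by
    rw [IsLocalization.AtPrime.ringKrullDim_eq_height P]
    exact (Ideal.height_le_ringKrullDim_of_ne_top hP.ne_top).trans hdim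
  refine ⟨_, hmem, hreg, le_antisymm ?_ (by simpa [hl] using h3)⟩
  rw [← h2]
  have : Nontrivial (Localization.AtPrime P ⧸ Ideal.ofList
      ((rs.map (algebraMap _ (MvPolynomial σ k ⧸ J))).map
        (algebraMap _ (Localization.AtPrime P)))) :=
    Ideal.Quotient.nontrivial_iff.2 fun h => hreg.2 (by rw [h, Submodule.top_smul])
  exact le_add_of_nonneg_left ringKrullDim_nonneg_of_nontrivial

end CohenMacaulay

/-! ### Ideals of binary forms that are saturated with respect to the variables -/

section BinaryForms

open MvPolynomial Matrix

variable {A : Type*} [CommRing A]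

/-- The forms of degree `m` in an ideal `I` of `A[x₀, x₁]`, as a module over `A`. -/
def formsIn (I : Ideal (MvPolynomial (Fin 2) A)) (m : ℕ) :
    Submodule A (MvPolynomial (Fin 2) A) :=
  I.restrictScalars A ⊓ homogeneousSubmodule (Fin 2) A m

lemma mem_formsIn {I : Ideal (MvPolynomial (Fin 2) A)} {m : ℕ} {f : MvPolynomial (Fin 2) A} :
    f ∈ formsIn I m ↔ f ∈ I ∧ f.IsHomogeneous m := Iff.rfl

/-- An ideal of `A[x₀, x₁]` is saturated if it equals its quotient by `⟨x₀, x₁⟩`. -/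
def VarSaturated (I : Ideal (MvPolynomial (Fin 2) A)) : Prop :=
  ∀ z, X 0 * z ∈ I → X 1 * z ∈ I → z ∈ I

lemma VarSaturated.mem_of_pow_mul_mem {I : Ideal (MvPolynomial (Fin 2) A)} (hI : VarSaturated I)
    {p q : ℕ} {z : MvPolynomial (Fin 2) A} (h0 : X 0 ^ p * z ∈ I) (h1 : X 1 ^ q * z ∈ I) :
    z ∈ I := by
  induction p generalizing z with
  | zero => simpa using h0
  | succ p ih =>
    have h2 : X 0 * z ∈ I := ih (by rwa [← mul_assoc, ← pow_succ]) (by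
      rw [mul_left_comm]; exact I.mul_mem_left _ h1)
    clear h0 ih
    induction q generalizing z with
    | zero => simpa using h1
    | succ q ih =>
      refine hI z h2 (ih (by rwa [← mul_assoc, ← pow_succ]) ?_)
      rw [mul_left_comm]; exact I.mul_mem_left _ h2

lemma X_mul_mem_formsIn {I : Ideal (MvPolynomial (Fin 2) A)} {m : ℕ}
    {f : MvPolynomial (Fin 2) A} (hf : f ∈ formsIn I m) (i : Fin 2) :
    X i * f ∈ formsIn I (m + 1) :=
  ⟨I.mul_mem_left _ hf.1, add_comm 1 m ▸ (isHomogeneous_X A i).mul hf.2⟩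

section Syzygies

variable {I : Ideal (MvPolynomial (Fin 2) A)} {m s t : ℕ}
  (f : Module.Basis (Fin s) A (formsIn I (m + 1))) (h : Module.Basis (Fin t) A (formsIn I m))

/-- The coefficients of `x_i h_j` in terms of the basis `f`. -/
def mulVarCoeff (i : Fin 2) (a : Fin s) (j : Fin t) : A :=
  f.repr ⟨X i * (h j : MvPolynomial (Fin 2) A), X_mul_mem_formsIn (h j).2 i⟩ a

lemma sum_mulVarCoeff (i : Fin 2) (j : Fin t) :
    ∑ a, C (mulVarCoeff f h i a j) * (f a : MvPolynomial (Fin 2) A) =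
      X i * (h j : MvPolynomial (Fin 2) A) := by
  have := congrArg Subtype.val
    (f.sum_repr ⟨X i * (h j : MvPolynomial (Fin 2) A), X_mul_mem_formsIn (h j).2 i⟩)
  refine Eq.trans ?_ this
  rw [AddSubmonoidClass.coe_finsetSum]
  exact Finset.sum_congr rfl fun a _ => (smul_eq_C_mul _ _).symm

/-- The matrix of the linear syzygies between the forms of degree `m + 1` in `I`. -/
def syzygyMatrix : Matrix (Fin s) (Fin t) (MvPolynomial (Fin 2) A) :=
  Matrix.of fun a j => X 1 * C (mulVarCoeff f h 0 a j) - X 0 * C (mulVarCoeff f h 1 a j)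

/-- Column `j` expresses `x₁(x₀h_j) - x₀(x₁h_j) = 0` in terms of `f`. -/
lemma vecMul_syzygyMatrix :
    (fun a => (f a : MvPolynomial (Fin 2) A)) ᵥ* syzygyMatrix f h = 0 := by
  ext1 j
  have h0 := sum_mulVarCoeff f h 0 j
  have h1 := sum_mulVarCoeff f h 1 j
  calc ∑ a, (f a : MvPolynomial (Fin 2) A) *
        (X 1 * C (mulVarCoeff f h 0 a j) - X 0 * C (mulVarCoeff f h 1 a j))
      = X 1 * ∑ a, C (mulVarCoeff f h 0 a j) * (f a : MvPolynomial (Fin 2) A) -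
        X 0 * ∑ a, C (mulVarCoeff f h 1 a j) * (f a : MvPolynomial (Fin 2) A) := by
        rw [Finset.mul_sum, Finset.mul_sum, ← Finset.sum_sub_distrib]
        exact Finset.sum_congr rfl fun a _ => by ring
    _ = 0 := by rw [h0, h1]; ring

/-- The coefficient at the exponent `e` of `∑ j, v j ⊗ h j`. -/
def coeffComb (e : Fin 2 →₀ ℕ) (v : Fin t → MvPolynomial (Fin 2) A) : MvPolynomial (Fin 2) A :=
  ∑ j, C (coeff e (v j)) * (h j : MvPolynomial (Fin 2) A)

lemma coeffComb_mem (e : Fin 2 →₀ ℕ) (v : Fin t → MvPolynomial (Fin 2) A) :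
    coeffComb h e v ∈ formsIn I m :=
  Submodule.sum_mem _ fun j _ => by
    rw [← smul_eq_C_mul]
    exact Submodule.smul_mem _ _ (h j).2

/-- Read `v` as an element of `A[x] ⊗ I_m`. The syzygy matrix is multiplication by `x₁ ⊗ x₀ - x₀ ⊗
x₁` into `A[x] ⊗ I_{m+1}`; here the coefficient at `e` is taken in the left tensor factor. -/
lemma sum_coeff_syzygyMatrix_mulVec (v : Fin t → MvPolynomial (Fin 2) A) (e : Fin 2 →₀ ℕ) :
    ∑ a, C (coeff e ((syzygyMatrix f h *ᵥ v) a)) * (f a : MvPolynomial (Fin 2) A) =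
      X 0 * coeffComb h e (fun j => X 1 * v j) - X 1 * coeffComb h e (fun j => X 0 * v j) := by
  have key : ∀ a, coeff e ((syzygyMatrix f h *ᵥ v) a) =
      ∑ j, (mulVarCoeff f h 0 a j * coeff e (X 1 * v j) -
        mulVarCoeff f h 1 a j * coeff e (X 0 * v j)) := by
    intro a
    rw [mulVec, dotProduct, coeff_sum]
    refine Finset.sum_congr rfl fun j _ => ?_
    rw [← coeff_C_mul, ← coeff_C_mul, ← coeff_sub]
    congr 1
    simp only [syzygyMatrix, of_apply]
    ring
  simp only [key, map_sum, Finset.sum_mul, coeffComb, Finset.mul_sum]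
  rw [Finset.sum_comm, ← Finset.sum_sub_distrib]
  refine Finset.sum_congr rfl fun j _ => ?_
  rw [mul_left_comm, mul_left_comm (X 1), ← sum_mulVarCoeff f h 0 j, ← sum_mulVarCoeff f h 1 j,
    Finset.mul_sum, Finset.mul_sum, ← Finset.sum_sub_distrib]
  refine Finset.sum_congr rfl fun a _ => ?_
  simp only [map_sub, map_mul]
  ring

lemma coeffComb_add_single_X_mul (i : Fin 2) (e : Fin 2 →₀ ℕ)
    (v : Fin t → MvPolynomial (Fin 2) A) :
    coeffComb h (e + Finsupp.single i 1) (fun j => X i * v j) = coeffComb h e v := by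
  simp [coeffComb, add_comm e, coeff_X_mul]

lemma coeffComb_X_mul_eq_zero {i : Fin 2} {e : Fin 2 →₀ ℕ} (he : e i = 0)
    (v : Fin t → MvPolynomial (Fin 2) A) :
    coeffComb h e (fun j => X i * v j) = 0 := by
  simp [coeffComb, coeff_X_mul', he]

/-- Vectors that the syzygy matrix kills modulo an ideal `K` are killed modulo `K` by powers of
the variables. -/
lemma X_pow_mul_coeffComb_mem {K : Ideal (MvPolynomial (Fin 2) A)}
    {v : Fin t → MvPolynomial (Fin 2) A} {i j : Fin 2} (hij : i ≠ j)
    (hK : ∀ e, X i * coeffComb h e (fun l => X j * v l) -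
      X j * coeffComb h e (fun l => X i * v l) ∈ K) (p : ℕ) (e : Fin 2 →₀ ℕ) (he : e i = p) :
    X i ^ (p + 1) * coeffComb h e v ∈ K := by
  induction p generalizing e with
  | zero =>
    have := hK (e + Finsupp.single j 1)
    rwa [coeffComb_add_single_X_mul, coeffComb_X_mul_eq_zero h (by simp [he, hij.symm]),
      mul_zero, sub_zero, ← pow_one (X i : MvPolynomial (Fin 2) A)] at this
  | succ p ih =>
    obtain ⟨e', rfl⟩ : ∃ e', e = e' + Finsupp.single i 1 :=
      ⟨e - Finsupp.single i 1, (tsub_add_cancel_of_le (by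
        rw [Finsupp.single_le_iff]; omega)).symm⟩
    -- Modulo `K`, `X i` times the coefficient at `e' + single i 1` equals `X j` times the one at
    -- `e' + single j 1`, whose `i`-exponent is smaller.
    have h1 := hK (e' + Finsupp.single i 1 + Finsupp.single j 1)
    rw [coeffComb_add_single_X_mul, add_right_comm, coeffComb_add_single_X_mul] at h1
    have h2 := ih (e' + Finsupp.single j 1) (by simpa [hij.symm] using he)
    have h3 := K.add_mem (K.mul_mem_left (X i ^ (p + 1)) h1) (K.mul_mem_left (X j) h2)
    convert h3 using 1
    ring

/-- A prime `π` of `A` divides no power of a variable, so it divides `y`; saturation puts the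
quotient in `I`. Admitting `π = 0` lets one argument cover injectivity over the domain and modulo
every prime. -/
lemma exists_eq_C_mul_of_X_pow_mul_mem [IsDomain A] (hI : VarSaturated I) {π : A}
    (hπ : π = 0 ∨ Prime π) {y : MvPolynomial (Fin 2) A} (hy : y.IsHomogeneous m) {p q : ℕ}
    (h0 : X 0 ^ p * y ∈ Ideal.span {C π} * I) (h1 : X 1 ^ q * y ∈ Ideal.span {C π} * I) :
    ∃ y' ∈ formsIn I m, y = C π * y' := by
  rw [Ideal.mem_span_singleton_mul] at h0 h1
  obtain ⟨z0, hz0, h0⟩ := h0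
  obtain ⟨z1, hz1, h1⟩ := h1
  rcases hπ with rfl | hπ
  · refine ⟨0, Submodule.zero_mem _, ?_⟩
    simpa [X_ne_zero] using h0.symm
  · have hC : Prime (C π : MvPolynomial (Fin 2) A) := (prime_C_iff _).2 hπ
    obtain ⟨y', rfl⟩ : C π ∣ y := by
      refine (hC.dvd_or_dvd (Dvd.intro _ h0)).resolve_left fun hd => ?_
      have := hC.dvd_of_dvd_pow hd
      rw [C_dvd_iff_dvd_coeff] at this
      have h2 := this (Finsupp.single 0 1)
      rw [coeff_X, if_pos rfl] at h2
      exact hπ.not_isUnit (isUnit_of_dvd_one h2)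
    refine ⟨y', ⟨hI.mem_of_pow_mul_mem (p := p) (q := q) ?_ ?_, ?_⟩, rfl⟩
    · rwa [← mul_left_cancel₀ hC.ne_zero (h0.trans (mul_left_comm _ _ _))]
    · rwa [← mul_left_cancel₀ hC.ne_zero (h1.trans (mul_left_comm _ _ _))]
    · intro e he
      refine hy ?_
      rw [coeff_C_mul]
      exact mul_ne_zero hπ.ne_zero he

/-- Each combination `coeffComb h e v` is killed by powers of both variables modulo `π I`, hence
lies in `π I_m`; since `h` is a basis, its coordinates are multiples of `π`. -/
lemma exists_eq_C_smul_of_syzygyMatrix_mulVec [IsDomain A] (hI : VarSaturated I) {π : A}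
    (hπ : π = 0 ∨ Prime π) {v : Fin t → MvPolynomial (Fin 2) A}
    (hv : ∀ a, C π ∣ (syzygyMatrix f h *ᵥ v) a) (j : Fin t) : C π ∣ v j := by
  have hK : ∀ e, X 0 * coeffComb h e (fun l => X 1 * v l) -
      X 1 * coeffComb h e (fun l => X 0 * v l) ∈ Ideal.span {C π} * I := by
    intro e
    rw [← sum_coeff_syzygyMatrix_mulVec f h v e]
    refine Submodule.sum_mem _ fun a _ => Ideal.mul_mem_mul ?_ (f a).2.1
    rw [Ideal.mem_span_singleton]
    exact map_dvd C ((C_dvd_iff_dvd_coeff _ _).1 (hv a) e)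
  have hK' : ∀ e, X 1 * coeffComb h e (fun l => X 0 * v l) -
      X 0 * coeffComb h e (fun l => X 1 * v l) ∈ Ideal.span {C π} * I := fun e => by
    rw [← neg_sub]
    exact neg_mem (hK e)
  rw [C_dvd_iff_dvd_coeff]
  intro e
  obtain ⟨y, hy, hey⟩ := exists_eq_C_mul_of_X_pow_mul_mem hI hπ (coeffComb_mem h e v).2
    (X_pow_mul_coeffComb_mem h (by decide) hK _ e rfl)
    (X_pow_mul_coeffComb_mem h (by decide) hK' _ e rfl)
  have h1 : ∑ j, coeff e (v j) • h j = π • (⟨y, hy⟩ : formsIn I m) := by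
    apply Subtype.ext
    simpa [smul_eq_C_mul, coeffComb] using hey
  have h2 := congrArg (fun z => h.repr z j) h1
  simp only [h.repr_sum_self, map_smul, Finsupp.smul_apply, smul_eq_mul] at h2
  exact Dvd.intro _ h2.symm

end Syzygies

lemma MvPolynomial.IsHomogeneous.det {σ : Type*} {n d : ℕ}
    {M : Matrix (Fin n) (Fin n) (MvPolynomial σ A)} (hM : ∀ i j, (M i j).IsHomogeneous d) :
    M.det.IsHomogeneous (n * d) := by
  rw [det_apply]
  refine IsHomogeneous.sum _ _ _ fun τ _ => ?_
  have h1 := IsHomogeneous.prod Finset.univ (fun i => M (τ i) i) (fun _ => d) fun i _ => hM _ _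
  have h2 : (∏ i, M (τ i) i).IsHomogeneous (n * d) := by simpa using h1
  rcases Int.units_eq_one_or (Equiv.Perm.sign τ) with h | h <;> rw [h]
  · simpa using h2
  · simpa using h2.neg

section Minors

variable {I : Ideal (MvPolynomial (Fin 2) A)} {m : ℕ}
  (f : Module.Basis (Fin (m + 2)) A (formsIn I (m + 1)))
  (h : Module.Basis (Fin (m + 1)) A (formsIn I m))

lemma isHomogeneous_signedMinor_syzygyMatrix (i : Fin (m + 2)) :
    (signedMinor (syzygyMatrix f h) i).IsHomogeneous (m + 1) := by
  have h1 : ((syzygyMatrix f h).submatrix i.succAbove id).det.IsHomogeneous ((m + 1) * 1) :=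
    IsHomogeneous.det fun a j =>
      ((isHomogeneous_X A 1).mul (isHomogeneous_C _ _)).sub
        ((isHomogeneous_X A 0).mul (isHomogeneous_C _ _))
  rw [mul_one] at h1
  rw [signedMinor]
  rcases neg_one_pow_eq_or (MvPolynomial (Fin 2) A) (i : ℕ) with h2 | h2 <;> rw [h2]
  · simpa using h1
  · simpa using h1.neg

lemma not_C_dvd_signedMinor_syzygyMatrix [IsDomain A] (hI : VarSaturated I) {π : A}
    (hπ : π = 0 ∨ Prime π) {i : Fin (m + 2)}
    (hi : ¬ C π ∣ (f i : MvPolynomial (Fin 2) A)) :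
    ¬ C π ∣ signedMinor (syzygyMatrix f h) i := by
  intro hd
  let M := syzygyMatrix f h
  let K : Ideal (MvPolynomial (Fin 2) A) := Ideal.span {C π}
  have hK : K.IsPrime := by
    rcases hπ with rfl | hπ
    · simpa [K] using Ideal.isPrime_bot
    · have hC : Prime (C π : MvPolynomial (Fin 2) A) := (prime_C_iff _).2 hπ
      exact (Ideal.span_singleton_prime hC.ne_zero).2 hC
  let N := M.submatrix i.succAbove id
  have hN : ((Ideal.Quotient.mk K).mapMatrix N).det = 0 := by
    rw [← RingHom.map_det, Ideal.Quotient.eq_zero_iff_mem, Ideal.mem_span_singleton]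
    rwa [signedMinor, (isUnit_one.neg.pow _).dvd_mul_left] at hd
  obtain ⟨v', hv', hNv⟩ := exists_mulVec_eq_zero_iff.2 hN
  choose v hv using fun j => Ideal.Quotient.mk_surjective (v' j)
  obtain rfl : (fun j => Ideal.Quotient.mk K (v j)) = v' := funext hv
  have h1 : ∀ a, C π ∣ (M *ᵥ v) (i.succAbove a) := by
    intro a
    rw [← Ideal.mem_span_singleton, ← Ideal.Quotient.eq_zero_iff_mem]
    have := congrFun hNv a
    simpa [mulVec, dotProduct, N] using this
  -- The deleted row is recovered from the relation `f ᵥ* M = 0`, because `f i` is nonzero modulo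
  -- `π`. The vector `v` then contradicts injectivity modulo `π`.
  have h2 : C π ∣ (M *ᵥ v) i := by
    have h3 : (fun a => (f a : MvPolynomial (Fin 2) A)) ⬝ᵥ (M *ᵥ v) = 0 := by
      rw [dotProduct_mulVec, vecMul_syzygyMatrix, zero_dotProduct]
    rw [dotProduct, Fin.sum_univ_succAbove _ i] at h3
    have h4 : C π ∣ (f i : MvPolynomial (Fin 2) A) * (M *ᵥ v) i := by
      rw [eq_neg_of_add_eq_zero_left h3, dvd_neg]
      exact Finset.dvd_sum fun a _ => (h1 a).mul_left _
    rw [← Ideal.mem_span_singleton] at h4 hi ⊢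
    exact (hK.mem_or_mem h4).resolve_left hi
  refine hv' (funext fun j => ?_)
  rw [Pi.zero_apply, Ideal.Quotient.eq_zero_iff_mem, Ideal.mem_span_singleton]
  refine exists_eq_C_smul_of_syzygyMatrix_mulVec f h hI hπ (fun a => ?_) j
  rcases Fin.eq_self_or_eq_succAbove i a with rfl | ⟨b, rfl⟩
  · exact h2
  · exact h1 b

/-- The maximal minors of the syzygy matrix are, up to a unit, the given basis of forms. -/
lemma exists_isUnit_signedMinor_syzygyMatrix [IsDomain A] [UniqueFactorizationMonoid A]
    (hI : VarSaturated I)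
    (hf : ∀ p : MvPolynomial (Fin 2) A, Prime p → ∃ i, ¬ p ∣ (f i : MvPolynomial (Fin 2) A)) :
    ∃ q : MvPolynomial (Fin 2) A, IsUnit q ∧
      ∀ i, signedMinor (syzygyMatrix f h) i = q * (f i : MvPolynomial (Fin 2) A) := by
  have hf0 : (f 0 : MvPolynomial (Fin 2) A) ≠ 0 := fun h0 => f.ne_zero 0 (Subtype.ext h0)
  have hd0 : signedMinor (syzygyMatrix f h) 0 ≠ 0 := by
    simpa using not_C_dvd_signedMinor_syzygyMatrix f h hI (.inl rfl) (i := 0) (by simpa using hf0)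
  have hmul := signedMinor_mul_eq hd0 (vecMul_syzygyMatrix f h)
  obtain ⟨q, hq⟩ := dvd_of_forall_dvd_mul_of_no_common_prime hf hf0
    (x := signedMinor (syzygyMatrix f h) 0) fun i => Dvd.intro _ (hmul i).symm
  have hq' : ∀ i, signedMinor (syzygyMatrix f h) i = q * (f i : MvPolynomial (Fin 2) A) := by
    intro i
    apply mul_left_cancel₀ hf0
    rw [← hmul i, hq, mul_assoc]
  refine ⟨q, ?_, hq'⟩
  have hq0 : q ≠ 0 := by
    rintro rfl
    exact hd0 (by simpa using hq)
  -- Minors and basis forms both have `x`-degree `m + 1`, so the ratio `q` lies in `A`.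
  have hdeg : q.totalDegree = 0 := by
    have h1 := (isHomogeneous_signedMinor_syzygyMatrix f h 0).totalDegree hd0
    rw [hq, totalDegree_mul_of_isDomain hf0 hq0,
      IsHomogeneous.totalDegree (f 0).2.2 hf0] at h1
    omega
  rw [totalDegree_eq_zero_iff_eq_C] at hdeg
  obtain ⟨c, rfl⟩ : ∃ c, q = C c := ⟨_, hdeg⟩
  refine IsUnit.map C ?_
  by_contra hc
  obtain ⟨π, hπ, hπc⟩ := WfDvdMonoid.exists_irreducible_factor hc (by simpa using hq0)
  obtain ⟨i, hi⟩ := hf _ ((prime_C_iff _).2 hπ.prime)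
  refine not_C_dvd_signedMinor_syzygyMatrix f h hI (.inr hπ.prime) hi ?_
  rw [hq']
  exact (map_dvd C hπc).mul_right _

end Minors

end BinaryForms

/-! ### Freeness of saturated graded modules over `k[y₀, y₁]` -/

section Freeness

open MvPolynomial

variable {k : Type*} [Field k]

/-- All coefficients of `f` are forms of degree `d`. -/
def HasHomogeneousCoeffs {σ τ : Type*} (f : MvPolynomial σ (MvPolynomial τ k)) (d : ℕ) : Prop :=
  ∀ e, (coeff e f).IsHomogeneous d

lemma homogeneousComponent_mul_of_isHomogeneous {R τ : Type*} [CommRing R]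
    {r g : MvPolynomial τ R} {j : ℕ}
    (hg : g.IsHomogeneous j) (n : ℕ) :
    homogeneousComponent n (r * g) =
      if j ≤ n then homogeneousComponent (n - j) r * g else 0 := by
  let : GradedAlgebra (homogeneousSubmodule τ R) := MvPolynomial.gradedAlgebra
  have h (f : MvPolynomial τ R) (i : ℕ) :
      (DirectSum.decompose (homogeneousSubmodule τ R) f i : MvPolynomial τ R) =
        homogeneousComponent i f := decomposition.decompose'_apply f i
  split_ifs with hj
  · have := DirectSum.coe_decompose_mul_of_right_mem_of_le (homogeneousSubmodule τ R)
      (a := r) ((mem_homogeneousSubmodule j g).2 hg) hj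
    rwa [h, h] at this
  · have := DirectSum.coe_decompose_mul_of_right_mem_of_not_le (homogeneousSubmodule τ R)
      (a := r) ((mem_homogeneousSubmodule j g).2 hg) hj
    rwa [h] at this

lemma exists_eq_X_mul_add_X_mul {R : Type*} [CommRing R]
    {r : MvPolynomial (Fin 2) R} (hr : coeff 0 r = 0) :
    ∃ u w, r = X 0 * u + X 1 * w := by
  have h1 : r ∈ idealOfVars (Fin 2) R ^ 1 := by
    rw [mem_pow_idealOfVars_iff']
    intro e he
    obtain rfl : e = 0 := by
      rw [← Finsupp.degree_eq_zero_iff]; omega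
    exact hr
  rw [pow_one, idealOfVars, show Set.range (X : Fin 2 → MvPolynomial (Fin 2) R) = {X 0, X 1} by
    ext; simp [eq_comm], Ideal.mem_span_pair] at h1
  obtain ⟨u, w, h⟩ := h1
  exact ⟨u, w, by rw [← h]; ring⟩

/-- In a relation between homogeneous generators, the part of degree `d i` has the constant term of
`r i` as its coefficient at `g i`. If that were nonzero, `g i` would be redundant. -/
lemma coeff_zero_eq_zero_of_sum_smul_eq_zero {σ τ ι : Type*} [Fintype ι]
    {g : ι → MvPolynomial σ (MvPolynomial τ k)} (hg : ∀ i, ∃ d, HasHomogeneousCoeffs (g i) d)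
    {i : ι} (hi : g i ∉ Submodule.span (MvPolynomial τ k) (g '' {j | j ≠ i}))
    {r : ι → MvPolynomial τ k} (hr : ∑ j, r j • g j = 0) : coeff 0 (r i) = 0 := by
  classical
  choose d hd using hg
  let s : ι → MvPolynomial τ k := fun j =>
    if d j ≤ d i then homogeneousComponent (d i - d j) (r j) else 0
  have hs : ∑ j, s j • g j = 0 := by
    ext1 e
    rw [coeff_zero, coeff_sum]
    have h1 := congrArg (fun f => homogeneousComponent (d i) (coeff e f)) hr
    simp only [coeff_sum, coeff_smul, map_sum, smul_eq_mul, coeff_zero, map_zero,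
      homogeneousComponent_mul_of_isHomogeneous (hd _ e)] at h1
    rw [← h1]
    refine Finset.sum_congr rfl fun j _ => ?_
    simp only [s, coeff_smul, smul_eq_mul]
    split_ifs <;> simp
  by_contra hc
  apply hi
  have hsi : s i = C (coeff 0 (r i)) := by
    simp [s, homogeneousComponent_zero]
  rw [← Finset.add_sum_erase _ _ (Finset.mem_univ i), hsi] at hs
  have h2 : g i = (C (-(coeff 0 (r i))⁻¹) : MvPolynomial τ k) •
      ∑ j ∈ Finset.univ.erase i, s j • g j := by
    rw [eq_neg_of_add_eq_zero_right hs, smul_neg, smul_smul, ← C_mul, neg_mul,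
      inv_mul_cancel₀ hc]
    simp
  rw [h2]
  refine Submodule.smul_mem _ _ (Submodule.sum_mem _ fun j hj => Submodule.smul_mem _ _ ?_)
  exact Submodule.subset_span ⟨j, (Finset.mem_erase.1 hj).1, rfl⟩

lemma exists_eq_X_smul_of_X_smul_eq {σ : Type*}
    {p q : MvPolynomial σ (MvPolynomial (Fin 2) k)}
    (h : (X 0 : MvPolynomial (Fin 2) k) • p = (X 1 : MvPolynomial (Fin 2) k) • q) :
    ∃ z, p = (X 1 : MvPolynomial (Fin 2) k) • z ∧ q = (X 0 : MvPolynomial (Fin 2) k) • z := by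
  classical
  have hX : Prime (X 1 : MvPolynomial (Fin 2) k) := X_prime
  rw [smul_eq_C_mul, smul_eq_C_mul] at h
  obtain ⟨z, hz⟩ : C (X 1) ∣ p := by
    refine (((prime_C_iff _).2 hX).dvd_or_dvd (Dvd.intro _ h.symm)).resolve_left fun hd => ?_
    rw [C_dvd_iff_dvd_coeff] at hd
    have := hd 0
    rw [coeff_C, if_pos rfl, X_dvd_X] at this
    simp at this
  refine ⟨z, by rw [hz, smul_eq_C_mul], ?_⟩
  rw [hz, mul_left_comm] at h
  rw [smul_eq_C_mul]
  exact (mul_left_cancel₀ (by simp) h).symm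

/-- A minimal system of homogeneous generators of a saturated module is linearly independent. -/
lemma linearIndependent_of_saturated {σ ι : Type*} [Fintype ι]
    {g : ι → MvPolynomial σ (MvPolynomial (Fin 2) k)}
    (hg : ∀ i, ∃ d, HasHomogeneousCoeffs (g i) d)
    (hmin : ∀ i, g i ∉ Submodule.span (MvPolynomial (Fin 2) k) (g '' {j | j ≠ i}))
    (hsat : ∀ z, (X 0 : MvPolynomial (Fin 2) k) • z ∈
      Submodule.span (MvPolynomial (Fin 2) k) (Set.range g) →
      (X 1 : MvPolynomial (Fin 2) k) • z ∈ Submodule.span (MvPolynomial (Fin 2) k) (Set.range g) →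
      z ∈ Submodule.span (MvPolynomial (Fin 2) k) (Set.range g)) :
    LinearIndependent (MvPolynomial (Fin 2) k) g := by
  rw [linearIndependent_iff_injective_fintypeLinearCombination, ← LinearMap.ker_eq_bot]
  set φ := Fintype.linearCombination (MvPolynomial (Fin 2) k) g with hφ
  let J : Ideal (MvPolynomial (Fin 2) k) := Ideal.span {X 0, X 1}
  have hrange : Submodule.span (MvPolynomial (Fin 2) k) (Set.range g) = LinearMap.range φ := by
    rw [hφ, Fintype.range_linearCombination]
  rw [hrange] at hsat
  -- A relation has the form `X 0 • u + X 1 • w`. Coprimality of the variables and saturation of the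
  -- span correct `u` and `w` by multiples of some `y` so that both become relations. Nakayama's
  -- lemma then kills the kernel.
  have hle : LinearMap.ker φ ≤ J • LinearMap.ker φ := by
    intro r hr
    have h0 : ∀ i, coeff 0 (r i) = 0 := fun i =>
      coeff_zero_eq_zero_of_sum_smul_eq_zero hg (hmin i) hr
    choose u w huw using fun i => exists_eq_X_mul_add_X_mul (h0 i)
    have hr' : r = (X 0 : MvPolynomial (Fin 2) k) • u + (X 1 : MvPolynomial (Fin 2) k) • w :=
      funext huw
    have h1 : (X 0 : MvPolynomial (Fin 2) k) • φ u = (X 1 : MvPolynomial (Fin 2) k) • φ (-w) := by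
      rw [LinearMap.mem_ker, hr', map_add, map_smul, map_smul] at hr
      rw [eq_neg_of_add_eq_zero_left hr, map_neg, smul_neg]
    obtain ⟨z, hz1, hz0⟩ := exists_eq_X_smul_of_X_smul_eq h1
    obtain ⟨y, rfl⟩ := hsat z ⟨_, hz0⟩ ⟨_, hz1⟩
    have hu : u - (X 1 : MvPolynomial (Fin 2) k) • y ∈ LinearMap.ker φ := by
      rw [LinearMap.mem_ker, map_sub, map_smul, hz1, sub_self]
    have hw : w + (X 0 : MvPolynomial (Fin 2) k) • y ∈ LinearMap.ker φ := by
      rw [LinearMap.mem_ker, map_add, map_smul, ← hz0, map_neg, add_neg_cancel]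
    have : r = (X 0 : MvPolynomial (Fin 2) k) • (u - (X 1 : MvPolynomial (Fin 2) k) • y) +
        (X 1 : MvPolynomial (Fin 2) k) • (w + (X 0 : MvPolynomial (Fin 2) k) • y) := by
      rw [hr', smul_sub, smul_add, smul_smul, smul_smul, mul_comm (X 1)]
      abel
    rw [this]
    exact add_mem (Submodule.smul_mem_smul (Ideal.subset_span (by simp)) hu)
      (Submodule.smul_mem_smul (Ideal.subset_span (by simp)) hw)
  obtain ⟨e, he, he0⟩ := Submodule.exists_sub_one_mem_and_smul_eq_zero_of_fg_of_le_smul J _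
    (IsNoetherian.noetherian _) hle
  have hne : e ≠ 0 := by
    rintro rfl
    have h2 : J ≤ RingHom.ker (constantCoeff : MvPolynomial (Fin 2) k →+* k) := by
      refine Ideal.span_le.2 ?_
      rintro _ (rfl | rfl) <;> simp
    have := h2 he
    simp at this
  rw [Submodule.eq_bot_iff]
  exact fun r hr => (smul_eq_zero.1 (he0 r hr)).resolve_left hne

/-- A homogeneous generating set of least cardinality is a basis. This is the graded case of a
module of depth two over a regular ring of dimension two. -/
lemma free_of_saturated {σ : Type*}
    {N : Submodule (MvPolynomial (Fin 2) k) (MvPolynomial σ (MvPolynomial (Fin 2) k))}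
    (hfg : N.FG) (hgen : N ≤ Submodule.span _ {g | g ∈ N ∧ ∃ d, HasHomogeneousCoeffs g d})
    (hsat : ∀ z, (X 0 : MvPolynomial (Fin 2) k) • z ∈ N →
      (X 1 : MvPolynomial (Fin 2) k) • z ∈ N → z ∈ N) :
    Module.Free (MvPolynomial (Fin 2) k) N := by
  classical
  have hspan : N = Submodule.span _ {g | g ∈ N ∧ ∃ d, HasHomogeneousCoeffs g d} :=
    le_antisymm hgen (Submodule.span_le.2 fun g hg => hg.1)
  have h1 : ∃ s : Finset (MvPolynomial σ (MvPolynomial (Fin 2) k)),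
      (∀ g ∈ s, ∃ d, HasHomogeneousCoeffs g d) ∧
      Submodule.span (MvPolynomial (Fin 2) k) (s : Set (MvPolynomial σ (MvPolynomial (Fin 2) k))) = N := by
    rw [hspan] at hfg
    obtain ⟨s, hs, hs'⟩ := (Submodule.fg_span_iff_fg_span_finset_subset _).1 hfg
    exact ⟨s, fun g hg => (hs hg).2, by rw [← hs', ← hspan]⟩
  obtain ⟨s, ⟨hsd, hsN⟩, hmin⟩ := exists_minimalFor_of_wellFoundedLT _ Finset.card h1
  have hrange : Set.range ((↑) : s → MvPolynomial σ (MvPolynomial (Fin 2) k)) = s :=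
    Subtype.range_coe
  have hli : LinearIndependent (MvPolynomial (Fin 2) k)
      ((↑) : s → MvPolynomial σ (MvPolynomial (Fin 2) k)) := by
    refine linearIndependent_of_saturated (fun i => hsd i i.2) (fun i hi => ?_) ?_
    · have himg : ((↑) : s → MvPolynomial σ (MvPolynomial (Fin 2) k)) '' {j | j ≠ i} =
          (s.erase i : Finset _) := by
        ext x
        rw [Finset.mem_coe, Finset.mem_erase]
        constructor
        · rintro ⟨j, hj, rfl⟩
          exact ⟨fun h => hj (Subtype.ext h), j.2⟩
        · exact fun h => ⟨⟨x, h.2⟩, fun h' => h.1 (congrArg Subtype.val h'), rfl⟩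
      rw [himg] at hi
      have h2 := hmin (j := s.erase i) ⟨fun g hg => hsd g (Finset.mem_of_mem_erase hg), ?_⟩
        (Finset.card_le_card (Finset.erase_subset _ _))
      · have := Finset.card_erase_lt_of_mem i.2
        omega
      · rw [← hsN]
        conv_rhs => rw [← Finset.insert_erase i.2, Finset.coe_insert,
          Submodule.span_insert_eq_span hi]
    · rwa [hrange, hsN]
  have := Module.Basis.span hli
  rw [hrange, hsN] at this
  exact Module.Free.of_basis this

end Freeness

/-! ### Truncations of saturated ideals of `k[y₀, y₁][x₀, x₁]` -/

section Truncation

open MvPolynomial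

lemma MvPolynomial.IsHomogeneous.exists_eq_X_mul_add_X_mul {R : Type*} [CommRing R]
    {f : MvPolynomial (Fin 2) R} {j : ℕ} (hf : f.IsHomogeneous (j + 1)) :
    ∃ u w : MvPolynomial (Fin 2) R, u.IsHomogeneous j ∧ w.IsHomogeneous j ∧
      f = X 0 * u + X 1 * w := by
  obtain ⟨u, w, h⟩ := _root_.exists_eq_X_mul_add_X_mul
    (hf.coeff_eq_zero (d := 0) (by simp))
  refine ⟨_, _, homogeneousComponent_isHomogeneous j u, homogeneousComponent_isHomogeneous j w, ?_⟩
  have h1 := congrArg (homogeneousComponent (j + 1)) h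
  rw [homogeneousComponent_eq_self hf, map_add, mul_comm (X 0), mul_comm (X 1),
    homogeneousComponent_mul_of_isHomogeneous (isHomogeneous_X R 0),
    homogeneousComponent_mul_of_isHomogeneous (isHomogeneous_X R 1), if_pos (by omega),
    if_pos (by omega), Nat.add_sub_cancel] at h1
  rw [h1, mul_comm (X 0), mul_comm (X 1)]

/-- An ideal is generated, as a group, by elements with a given property. -/
def IsSumOf {R : Type*} [CommRing R] (I : Ideal R) (P : R → Prop) : Prop :=
  ∀ f ∈ I, f ∈ AddSubmonoid.closure {g | g ∈ I ∧ P g}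

section General

variable {A : Type*} [CommRing A] {I : Ideal (MvPolynomial (Fin 2) A)}

lemma IsSumOf.homogeneousComponent_mem (hI : IsSumOf I fun g => ∃ i, g.IsHomogeneous i)
    {f : MvPolynomial (Fin 2) A} (hf : f ∈ I) (i : ℕ) : homogeneousComponent i f ∈ I := by
  have h := hI f hf
  clear hf
  induction h using AddSubmonoid.closure_induction with
  | mem g hg =>
    obtain ⟨hgI, j, hj⟩ := hg
    rw [homogeneousComponent_of_mem hj]
    split_ifs
    exacts [hgI, I.zero_mem]
  | zero => simp
  | add x y _ _ hx hy => rw [map_add]; exact I.add_mem hx hy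

/-- In large degrees, the forms in an ideal are generated by the forms of the preceding degree. -/
lemma IsSumOf.exists_formsIn_succ [IsNoetherianRing A]
    (hI : IsSumOf I fun g => ∃ i, g.IsHomogeneous i) :
    ∃ n₀, ∀ i ≥ n₀, ∀ f ∈ formsIn I (i + 1), ∃ u ∈ formsIn I i, ∃ w ∈ formsIn I i,
      f = X 0 * u + X 1 * w := by
  have hspan : I = Ideal.span {g | g ∈ I ∧ ∃ i, g.IsHomogeneous i} :=
    le_antisymm (fun f hf => AddSubmonoid.closure_le (S := (Ideal.span
      {g | g ∈ I ∧ ∃ i, g.IsHomogeneous i}).toAddSubmonoid).2 Ideal.subset_span (hI f hf))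
      (Ideal.span_le.2 fun g hg => hg.1)
  have hfg : I.FG := IsNoetherian.noetherian I
  rw [hspan] at hfg
  obtain ⟨T, hT, hT'⟩ := (Submodule.fg_span_iff_fg_span_finset_subset _).1 hfg
  have hTI : I = Ideal.span T := hspan.trans hT'
  choose! d hd using fun g (hg : g ∈ T) => (hT hg).2
  -- Beyond the largest generator degree, the homogeneous coefficients in degree `i + 1` have
  -- positive degree, so a variable splits off.
  refine ⟨T.sup d, fun i hi f hf => ?_⟩
  have hfT : f ∈ Ideal.span T := hTI ▸ (mem_formsIn.1 hf).1
  obtain ⟨c, -, hc⟩ := Submodule.mem_span_finset.1 hfT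
  have hdi : ∀ g ∈ T, d g ≤ i := fun g hg => (Finset.le_sup hg).trans hi
  have h1 : ∀ g ∈ T, ∃ u w : MvPolynomial (Fin 2) A, u.IsHomogeneous (i - d g) ∧
      w.IsHomogeneous (i - d g) ∧
      homogeneousComponent (i + 1) (c g • g) = (X 0 * u + X 1 * w) * g := by
    intro g hg
    have h2 := homogeneousComponent_isHomogeneous (i + 1 - d g) (c g)
    rw [Nat.sub_add_comm (hdi g hg)] at h2
    obtain ⟨u, w, hu, hw, h⟩ := h2.exists_eq_X_mul_add_X_mul
    refine ⟨u, w, hu, hw, ?_⟩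
    rw [smul_eq_mul, homogeneousComponent_mul_of_isHomogeneous (hd g hg),
      if_pos ((hdi g hg).trans (Nat.le_succ i)), ← h, Nat.sub_add_comm (hdi g hg)]
  choose! u w hu hw h1 using h1
  have hmem : ∀ v : MvPolynomial (Fin 2) A → MvPolynomial (Fin 2) A,
      (∀ g ∈ T, (v g).IsHomogeneous (i - d g)) → ∑ g ∈ T, v g * g ∈ formsIn I i := by
    intro v hv
    refine Submodule.sum_mem _ fun g hg => ⟨I.mul_mem_left _ (hT hg).1, ?_⟩
    have := (hv g hg).mul (hd g hg)
    rwa [Nat.sub_add_cancel (hdi g hg)] at this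
  refine ⟨_, hmem u hu, _, hmem w hw, ?_⟩
  rw [← homogeneousComponent_eq_self hf.2, ← hc, map_sum, Finset.sum_congr rfl h1,
    Finset.mul_sum, Finset.mul_sum, ← Finset.sum_add_distrib]
  exact Finset.sum_congr rfl fun g _ => by ring

/-- Intersecting with the `n`-th power of `⟨x₀, x₁⟩` keeps the components of degree at least `n`,
and `hn` brings each of these back to degree `n`. -/
lemma IsSumOf.inf_pow_idealOfVars_eq_span (hI : IsSumOf I fun g => ∃ i, g.IsHomogeneous i)
    {n : ℕ} (hn : ∀ i ≥ n, ∀ f ∈ formsIn I (i + 1), ∃ u ∈ formsIn I i, ∃ w ∈ formsIn I i,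
      f = X 0 * u + X 1 * w) {s : ℕ} (f : Module.Basis (Fin s) A (formsIn I n)) :
    I ⊓ idealOfVars (Fin 2) A ^ n =
      Ideal.span (Set.range fun a => (f a : MvPolynomial (Fin 2) A)) := by
  apply le_antisymm
  · have key : ∀ i ≥ n, ∀ g ∈ formsIn I i,
        g ∈ Ideal.span (Set.range fun a => (f a : MvPolynomial (Fin 2) A)) := by
      intro i hi
      induction i, hi using Nat.le_induction with
      | base =>
        intro g hg
        have := congrArg Subtype.val (f.sum_repr ⟨g, hg⟩)
        rw [AddSubmonoidClass.coe_finsetSum] at this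
        rw [show g = _ from this.symm]
        refine Ideal.sum_mem _ fun a _ => ?_
        rw [Submodule.coe_smul, smul_eq_C_mul]
        exact Ideal.mul_mem_left _ _ (Ideal.subset_span ⟨a, rfl⟩)
      | succ i hi ih =>
        intro g hg
        obtain ⟨u, hu, w, hw, rfl⟩ := hn i hi g hg
        exact Ideal.add_mem _ (Ideal.mul_mem_left _ _ (ih u hu)) (Ideal.mul_mem_left _ _ (ih w hw))
    rintro g ⟨hgI, hgn⟩
    rw [← sum_homogeneousComponent g]
    refine Ideal.sum_mem _ fun i _ => ?_
    rcases lt_or_ge i n with hi | hi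
    · convert Ideal.zero_mem _
      ext e
      rw [coeff_homogeneousComponent, coeff_zero]
      split_ifs with he
      · exact (mem_pow_idealOfVars_iff' _ _).1 hgn e (he ▸ hi)
      · rfl
    · exact key i hi _ ⟨hI.homogeneousComponent_mem hgI i, homogeneousComponent_isHomogeneous i g⟩
  · rw [Ideal.span_le]
    rintro _ ⟨a, rfl⟩
    refine ⟨(f a).2.1, (mem_pow_idealOfVars_iff' _ _).2 fun e he => ?_⟩
    exact IsHomogeneous.coeff_eq_zero (f a).2.2 he.ne

lemma fg_formsIn [IsNoetherianRing A] (I : Ideal (MvPolynomial (Fin 2) A)) (n : ℕ) :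
    (formsIn I n).FG := by
  have : Module.Finite A (homogeneousSubmodule (Fin 2) A n) :=
    Module.Finite.iff_fg.2 (homogeneousSubmodule_fg _ _ n)
  have hle : formsIn I n ≤ homogeneousSubmodule (Fin 2) A n := inf_le_right
  exact Module.Finite.iff_fg.1 (Module.Finite.of_injective
    (Submodule.inclusion hle) (Submodule.inclusion_injective hle))

lemma finrank_homogeneousSubmodule_fin_two [Nontrivial A] (n : ℕ) :
    Module.finrank A (homogeneousSubmodule (Fin 2) A n) = n + 1 := by
  have : Nat.card {d : Fin 2 →₀ ℕ | d.degree = n} = n + 1 := by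
    have e : {d : Fin 2 →₀ ℕ | d.degree = n} ≃ Fin (n + 1) :=
      { toFun d := ⟨d.1 0, by
          have : d.1.degree = n := d.2
          rw [Finsupp.degree_eq_sum, Fin.sum_univ_two] at this
          omega⟩
        invFun i := ⟨Finsupp.equivFunOnFinite.symm ![(i : ℕ), n - i], by
          have := i.2
          simp only [Set.mem_ofPred_eq, Finsupp.degree_eq_sum, Fin.sum_univ_two,
            Finsupp.equivFunOnFinite_symm_apply_apply, Matrix.cons_val_zero, Matrix.cons_val_one]
          omega⟩
        left_inv d := by
          have : d.1.degree = n := d.2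
          rw [Finsupp.degree_eq_sum, Fin.sum_univ_two] at this
          ext j
          fin_cases j <;> simp
          omega
        right_inv i := by ext; simp }
    rw [Nat.card_congr e, Nat.card_fin]
  rw [homogeneousSubmodule_eq_finsupp_supported]
  exact (Module.finrank_eq_nat_card_basis
    (basisRestrictSupport A {d : Fin 2 →₀ ℕ | d.degree = n})).trans this

/-- Multiplication by `G` embeds all forms of degree `n` into those in `I`, so the two ranks agree.
-/
lemma finrank_formsIn [IsDomain A] [IsNoetherianRing A] {G : A} (hG : G ≠ 0) (hGI : C G ∈ I)
    (n : ℕ) : Module.finrank A (formsIn I n) = n + 1 := by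
  have : Module.Finite A (homogeneousSubmodule (Fin 2) A n) :=
    Module.Finite.iff_fg.2 (homogeneousSubmodule_fg _ _ n)
  have : Module.Finite A (formsIn I n) := Module.Finite.iff_fg.2 (fg_formsIn I n)
  rw [← finrank_homogeneousSubmodule_fin_two (A := A) n]
  have hle : formsIn I n ≤ homogeneousSubmodule (Fin 2) A n := inf_le_right
  apply le_antisymm
  · exact LinearMap.finrank_le_finrank_of_injective (Submodule.inclusion_injective hle)
  · let φ : homogeneousSubmodule (Fin 2) A n →ₗ[A] formsIn I n :=
      (G • (homogeneousSubmodule (Fin 2) A n).subtype).codRestrict (formsIn I n) fun v =>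
        ⟨by
          simpa [smul_eq_C_mul] using I.mul_mem_right _ hGI,
          Submodule.smul_mem _ _ v.2⟩
    refine LinearMap.finrank_le_finrank_of_injective (f := φ) fun v w h => Subtype.ext ?_
    exact smul_right_injective _ hG (congrArg Subtype.val h)

end General

variable {k : Type*} [Field k] {I : Ideal (MvPolynomial (Fin 2) (MvPolynomial (Fin 2) k))}

lemma IsSumOf.free_formsIn
    (hI : IsSumOf I fun g => ∃ i d, g.IsHomogeneous i ∧ HasHomogeneousCoeffs g d)
    (hsat : ∀ z, C (X 0) * z ∈ I → C (X 1) * z ∈ I → z ∈ I) (n : ℕ) :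
    Module.Free (MvPolynomial (Fin 2) k) (formsIn I n) := by
  refine free_of_saturated (fg_formsIn I n) ?_ fun z h0 h1 => ?_
  · intro f hf
    suffices homogeneousComponent n f ∈ Submodule.span (MvPolynomial (Fin 2) k)
        {g | g ∈ formsIn I n ∧ ∃ d, HasHomogeneousCoeffs g d} by
      rwa [homogeneousComponent_eq_self hf.2] at this
    have h := hI f hf.1
    clear hf
    induction h using AddSubmonoid.closure_induction with
    | mem g hg =>
      obtain ⟨hgI, i, d, hi, hd⟩ := hg
      rw [homogeneousComponent_of_mem hi]
      split_ifs with h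
      · subst h
        exact Submodule.subset_span ⟨⟨hgI, hi⟩, d, hd⟩
      · exact Submodule.zero_mem _
    | zero => simp
    | add x y _ _ hx hy => rw [map_add]; exact Submodule.add_mem _ hx hy
  · rw [smul_eq_C_mul] at h0 h1
    refine ⟨hsat z h0.1 h1.1, fun e he => h0.2 ?_⟩
    rw [coeff_C_mul]
    exact mul_ne_zero (X_ne_zero 0) he

/-- A common prime factor of the truncation cannot divide both variables, so it divides all of `I`.
Dividing `G(y)` it lies in `A`; dividing `F(x)`, whose coefficients are in `k`, it is a unit. -/
lemma exists_not_dvd_of_mem_inf_pow_idealOfVars {G F : MvPolynomial (Fin 2) k} (hG : G ≠ 0)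
    (hGI : C G ∈ I) (hF : F ≠ 0) (hFI : map C F ∈ I) (n : ℕ)
    {p : MvPolynomial (Fin 2) (MvPolynomial (Fin 2) k)} (hp : Prime p) :
    ∃ x ∈ I ⊓ idealOfVars (Fin 2) (MvPolynomial (Fin 2) k) ^ n, ¬ p ∣ x := by
  by_contra! hall
  have key : ∀ x ∈ I, p ∣ x := by
    intro x hx
    have h : ∀ i, p ∣ x * X i ^ n := fun i => hall _ ⟨I.mul_mem_right _ hx,
      Ideal.mul_mem_left _ _ (Ideal.pow_mem_pow (Ideal.subset_span (Set.mem_range_self i)) n)⟩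
    by_contra hpx
    have h' : ∀ i, p ∣ X i := fun i =>
      hp.dvd_of_dvd_pow ((hp.dvd_or_dvd (h i)).resolve_left hpx)
    have h0 : Associated p (X 0) :=
      hp.irreducible.associated_of_dvd (X_prime.irreducible) (h' 0)
    have := h0.symm.dvd.trans (h' 1)
    rw [X_dvd_X] at this
    simp at this
  have hpG := key _ hGI
  obtain ⟨π, rfl⟩ : ∃ π, p = C π := by
    have h1 := totalDegree_le_of_dvd_of_isDomain hpG (by simpa using hG)
    rw [totalDegree_C, Nat.le_zero, totalDegree_eq_zero_iff_eq_C] at h1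
    exact ⟨_, h1⟩
  obtain ⟨e, he⟩ := ne_zero_iff.1 hF
  have h1 := (C_dvd_iff_dvd_coeff _ _).1 (key _ hFI) e
  rw [coeff_map] at h1
  exact hp.not_isUnit ((isUnit_of_dvd_unit h1 ((isUnit_iff_ne_zero.2 he).map C)).map C)

/-- A high truncation of a saturated bihomogeneous ideal that contains a nonzero form in either
set of variables is generated by the maximal minors of a matrix. -/
theorem IsSumOf.exists_maximalMinorsIdeal_eq
    (hI : IsSumOf I fun g => ∃ i d, g.IsHomogeneous i ∧ HasHomogeneousCoeffs g d)
    (hsat : VarSaturated I) (hsat' : ∀ z, C (X 0) * z ∈ I → C (X 1) * z ∈ I → z ∈ I)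
    {G F : MvPolynomial (Fin 2) k} (hG : G ≠ 0) (hGI : C G ∈ I) (hF : F ≠ 0)
    (hFI : map C F ∈ I) :
    ∃ (n : ℕ) (M : Matrix (Fin (n + 2)) (Fin (n + 1))
        (MvPolynomial (Fin 2) (MvPolynomial (Fin 2) k))),
      maximalMinorsIdeal M = I ⊓ idealOfVars (Fin 2) (MvPolynomial (Fin 2) k) ^ (n + 1) ∧
      ∀ p, Prime p → ∃ x ∈ maximalMinorsIdeal M, ¬ p ∣ x := by
  have hI' : IsSumOf I fun g => ∃ i, g.IsHomogeneous i := fun f hf => by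
    refine AddSubmonoid.closure_mono ?_ (hI f hf)
    rintro g ⟨hgI, i, d, hi, -⟩
    exact ⟨hgI, i, hi⟩
  obtain ⟨n, hn⟩ := hI'.exists_formsIn_succ
  have hfree := hI.free_formsIn hsat'
  have hrank := finrank_formsIn hG hGI
  have hfin : ∀ i, Module.Finite (MvPolynomial (Fin 2) k) (formsIn I i) := fun i =>
    Module.finite_of_finrank_pos (by rw [hrank]; omega)
  let f := Module.finBasisOfFinrankEq (MvPolynomial (Fin 2) k) (formsIn I (n + 1)) (hrank _)
  let h := Module.finBasisOfFinrankEq (MvPolynomial (Fin 2) k) (formsIn I n) (hrank _)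
  -- The truncation starts at `n + 1`, because the syzygies of its generators are indexed by a basis
  -- in the preceding degree.
  have hspan := hI'.inf_pow_idealOfVars_eq_span (n := n + 1)
    (fun i hi => hn i ((Nat.le_succ n).trans hi)) f
  obtain ⟨q, hq, hqf⟩ := exists_isUnit_signedMinor_syzygyMatrix f h hsat fun p hp => by
    obtain ⟨x, hx, hpx⟩ := exists_not_dvd_of_mem_inf_pow_idealOfVars hG hGI hF hFI (n + 1) hp
    by_contra! hall
    rw [hspan] at hx
    have hle : Ideal.span (Set.range fun a => (f a : MvPolynomial (Fin 2) _)) ≤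
        Ideal.span {p} := Ideal.span_le.2 (by
      rintro _ ⟨a, rfl⟩
      exact Ideal.mem_span_singleton.2 (hall a))
    exact hpx (Ideal.mem_span_singleton.1 (hle hx))
  have heq : maximalMinorsIdeal (syzygyMatrix f h) =
      I ⊓ idealOfVars (Fin 2) (MvPolynomial (Fin 2) k) ^ (n + 1) := by
    rw [hspan, ← span_range_signedMinor]
    apply le_antisymm <;> rw [Ideal.span_le] <;> rintro _ ⟨a, rfl⟩
    · rw [hqf]
      exact Ideal.mul_mem_left _ _ (Ideal.subset_span ⟨a, rfl⟩)
    · refine Ideal.mem_of_dvd _ ?_ (Ideal.subset_span (Set.mem_range_self (f := signedMinor _) a))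
      rw [hqf]
      exact hq.mul_left_dvd.2 dvd_rfl
  refine ⟨n, syzygyMatrix f h, heq, fun p hp => ?_⟩
  rw [heq]
  exact exists_not_dvd_of_mem_inf_pow_idealOfVars hG hGI hF hFI (n + 1) hp

end Truncation

/-! ### Zero-dimensional subschemes of the product of two projective lines -/

section ZeroDimensional

open TopologicalSpace

variable {k : Type u} [Field k]

lemma algebraMap_lineGrading_zero_surjective :
    Function.Surjective (algebraMap k (lineGrading k 0)) := by
  rintro ⟨f, hf⟩
  rw [MvPolynomial.mem_homogeneousSubmodule, ← MvPolynomial.totalDegree_zero_iff_isHomogeneous,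
    MvPolynomial.totalDegree_eq_zero_iff_eq_C] at hf
  exact ⟨MvPolynomial.coeff 0 f, Subtype.ext hf.symm⟩

instance finiteType_lineGrading :
    Algebra.FiniteType (lineGrading k 0) (MvPolynomial (Fin 2) k) :=
  have : IsScalarTower k (lineGrading k 0) (MvPolynomial (Fin 2) k) :=
    ⟨fun a b x => smul_mul_assoc a (b : MvPolynomial (Fin 2) k) x⟩
  .of_restrictScalars_finiteType k _ _

instance locallyOfFiniteType_projLineStr : LocallyOfFiniteType (projLineStr k) := by
  have : IsClosedImmersion (Spec.map (CommRingCat.ofHom (algebraMap k (lineGrading k 0)))) :=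
    IsClosedImmersion.spec_of_surjective _ algebraMap_lineGrading_zero_surjective
  unfold projLineStr
  infer_instance

instance quasiCompact_projLineStr : QuasiCompact (projLineStr k) := by
  have : IsClosedImmersion (Spec.map (CommRingCat.ofHom (algebraMap k (lineGrading k 0)))) :=
    IsClosedImmersion.spec_of_surjective _ algebraMap_lineGrading_zero_surjective
  unfold projLineStr
  infer_instance

instance locallyOfFiniteType_biProjStr : LocallyOfFiniteType (biProjStr k) := by
  unfold biProjStr biProjPr biProj
  infer_instance

instance quasiCompact_biProjStr : QuasiCompact (biProjStr k) := by
  unfold biProjStr biProjPr biProj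
  infer_instance

variable {Z : Scheme.{u}} (ι : Z ⟶ biProj k)

/-- The constants as functions on a preimage of a standard affine open. -/
def subschemeConst (c : Fin 2 → Fin 2) : k →+* Γ(Z, ι ⁻¹ᵁ biProjOpen k c) :=
  (ι.app (biProjOpen k c)).hom.comp (biProjConst k c)

lemma map_comp_subschemeConst (c : Fin 2 → Fin 2) {V : Z.Opens}
    (hV : V ≤ ι ⁻¹ᵁ biProjOpen k c) :
    (Z.presheaf.map (homOfLE hV).op).hom.comp (subschemeConst ι c) =
      ((Scheme.ΓSpecIso (.of k)).inv ≫ (ι ≫ biProjStr k).appLE ⊤ V le_top).hom := by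
  have : (Scheme.ΓSpecIso (.of k)).inv ≫ (ι ≫ biProjStr k).appLE ⊤ V le_top =
      ((Scheme.ΓSpecIso (.of k)).inv ≫ (biProjStr k).appTop ≫
        (biProj k).presheaf.map (homOfLE le_top).op) ≫ ι.app (biProjOpen k c) ≫
        Z.presheaf.map (homOfLE hV).op := by
    simp only [Category.assoc]
    congr 1
    rw [← Scheme.Hom.appLE, Scheme.Hom.map_appLE]
    exact Scheme.Hom.comp_appLE ι (biProjStr k) ⊤ V le_top
  rw [this]
  rfl

variable [IsClosedImmersion ι]

/-- Functions on an affine open form an Artinian `k`-algebra of finite type, hence a finite one. -/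
lemma isIntegralElem_of_isAffineOpen (hZ : topologicalKrullDim Z ≤ 0) (c : Fin 2 → Fin 2)
    {V : Z.Opens} (hVa : IsAffineOpen V) (hV : V ≤ ι ⁻¹ᵁ biProjOpen k c)
    (t : Γ(Z, V)) :
    ((Z.presheaf.map (homOfLE hV).op).hom.comp (subschemeConst ι c)).IsIntegralElem t := by
  have : IsLocallyNoetherian Z := LocallyOfFiniteType.isLocallyNoetherian (ι ≫ biProjStr k)
  have : IsLocallyArtinian Z := .of_topologicalKrullDim_le_zero hZ
  have : IsArtinianRing Γ(Z, V) := IsLocallyArtinian.isArtinianRing_presheaf_obj ⟨V, hVa⟩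
  have hft : ((Z.presheaf.map (homOfLE hV).op).hom.comp (subschemeConst ι c)).FiniteType := by
    rw [map_comp_subschemeConst]
    refine RingHom.FiniteType.comp (HasRingHomProperty.appLE @LocallyOfFiniteType
      (ι ≫ biProjStr k) inferInstance ⟨⊤, isAffineOpen_top _⟩ ⟨V, hVa⟩ le_top) ?_
    exact .of_surjective _ (Scheme.ΓSpecIso (.of k)).symm.commRingCatIsoToRingEquiv.surjective
  let := ((Z.presheaf.map (homOfLE hV).op).hom.comp (subschemeConst ι c)).toAlgebra
  have : Algebra.FiniteType k Γ(Z, V) := hft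
  have : Module.Finite k Γ(Z, V) := Module.finite_of_isArtinianRing k _
  exact Algebra.IsIntegral.isIntegral (R := k) t

/-- All functions on a zero-dimensional subscheme are integral over the base field. -/
lemma isIntegralElem_subschemeConst (hZ : topologicalKrullDim Z ≤ 0) (c : Fin 2 → Fin 2)
    (t : Γ(Z, ι ⁻¹ᵁ biProjOpen k c)) : (subschemeConst ι c).IsIntegralElem t := by
  have : IsLocallyNoetherian Z := LocallyOfFiniteType.isLocallyNoetherian (ι ≫ biProjStr k)
  have : IsLocallyArtinian Z := .of_topologicalKrullDim_le_zero hZ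
  have : CompactSpace Z := QuasiCompact.compactSpace_of_compactSpace (ι ≫ biProjStr k)
  have : IsArtinianScheme Z := {}
  have : Finite Z := inferInstance
  let U := ι ⁻¹ᵁ biProjOpen k c
  have : Fintype {z : Z // z ∈ U} := Fintype.ofFinite _
  -- `Z` is finite, so finitely many affine opens cover `U`; the product of the monic equations
  -- holds on each of them, hence on `U`.
  have hcov : ∀ z : {z : Z // z ∈ U}, ∃ V : Z.Opens, IsAffineOpen V ∧ z.1 ∈ V ∧ V ≤ U := fun z =>
    exists_isAffineOpen_mem_and_subset z.2
  choose V hVa hzV hVU using hcov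
  choose p hp hpt using fun z => isIntegralElem_of_isAffineOpen ι hZ c (hVa z) (hVU z)
    ((Z.presheaf.map (homOfLE (hVU z)).op).hom t)
  refine ⟨∏ z, p z, Polynomial.monic_prod_of_monic _ _ fun z _ => hp z, ?_⟩
  refine Z.sheaf.eq_of_locally_eq' V U (fun z => homOfLE (hVU z)) (fun z hz => ?_) _ _ fun z => ?_
  · exact Opens.mem_iSup.2 ⟨⟨z, hz⟩, hzV ⟨z, hz⟩⟩
  · have h1 := hpt z
    rw [← Polynomial.hom_eval₂] at h1
    have h2 : (Z.presheaf.map (homOfLE (hVU z)).op).hom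
        (Polynomial.eval₂ (subschemeConst ι c) t (∏ z, p z)) = 0 := by
      rw [Polynomial.eval₂_finsetProd, map_prod]
      exact Finset.prod_eq_zero (Finset.mem_univ z) h1
    refine h2.trans ?_
    exact (map_zero (Z.presheaf.map (homOfLE (hVU z)).op).hom).symm

end ZeroDimensional

/-! ### The Cox ring as an iterated polynomial ring -/

section CoxRing

open MvPolynomial

variable {k : Type u} [Field k]

/-- The Cox ring as a polynomial ring in the coordinates of the first factor over the polynomial
ring in the coordinates of the second factor. -/
def coxEquiv (k : Type u) [Field k] :
    CoxRing k ≃ₐ[k] MvPolynomial (Fin 2) (MvPolynomial (Fin 2) k) :=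
  (renameEquiv k ((finTwoEquiv.prodCongr (.refl _)).trans (Equiv.boolProdEquivSum (Fin 2)))).trans
    (sumAlgEquiv k (Fin 2) (Fin 2))

lemma coxEquiv_X_zero (j : Fin 2) : coxEquiv k (X (0, j)) = X j := by
  simp [coxEquiv, finTwoEquiv]

lemma coxEquiv_X_one (j : Fin 2) : coxEquiv k (X (1, j)) = C (X j) := by
  simp [coxEquiv, finTwoEquiv]

lemma coxEquiv_symm_X (j : Fin 2) : (coxEquiv k).symm (X j) = X (0, j) := by
  rw [← coxEquiv_X_zero, AlgEquiv.symm_apply_apply]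

lemma coxEquiv_symm_C_X (j : Fin 2) : (coxEquiv k).symm (C (X j)) = X (1, j) := by
  rw [← coxEquiv_X_one, AlgEquiv.symm_apply_apply]

lemma coxEquiv_C (r : k) : coxEquiv k (C r) = C (C r) :=
  (coxEquiv k).commutes r

lemma coxEquiv_rename_zero (F : MvPolynomial (Fin 2) k) :
    coxEquiv k (rename (fun l => ((0 : Fin 2), l)) F) = map C F := by
  induction F using MvPolynomial.induction_on with
  | C r => rw [rename_C, coxEquiv_C, map_C]
  | add p q hp hq => simp only [map_add, hp, hq]
  | mul_X p j hp => simp only [map_mul, hp, rename_X, coxEquiv_X_zero, map_X]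

lemma coxEquiv_rename_one (G : MvPolynomial (Fin 2) k) :
    coxEquiv k (rename (fun l => ((1 : Fin 2), l)) G) = C G := by
  induction G using MvPolynomial.induction_on with
  | C r => rw [rename_C, coxEquiv_C]
  | add p q hp hq => simp only [map_add, hp, hq]
  | mul_X p j hp => simp only [map_mul, hp, rename_X, coxEquiv_X_one]

lemma HasHomogeneousCoeffs.mul {σ τ : Type*} {f g : MvPolynomial σ (MvPolynomial τ k)} {a b : ℕ}
    (hf : HasHomogeneousCoeffs f a) (hg : HasHomogeneousCoeffs g b) :
    HasHomogeneousCoeffs (f * g) (a + b) := by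
  classical
  intro e
  rw [coeff_mul]
  exact IsHomogeneous.sum _ _ _ fun x _ => (hf x.1).mul (hg x.2)

lemma isHomogeneous_coxEquiv_monomial (m : Fin 2 × Fin 2 →₀ ℕ) (r : k) :
    (coxEquiv k (monomial m r)).IsHomogeneous (Finsupp.weight coxWeight m 0) ∧
      HasHomogeneousCoeffs (coxEquiv k (monomial m r)) (Finsupp.weight coxWeight m 1) := by
  classical
  have hC : ∀ r : k, HasHomogeneousCoeffs
      (C (C r) : MvPolynomial (Fin 2) (MvPolynomial (Fin 2) k)) 0 := by
    intro r e
    rw [coeff_C]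
    split_ifs
    exacts [isHomogeneous_C _ _, isHomogeneous_zero _ _ _]
  have hX : ∀ v : Fin 2 × Fin 2, (coxEquiv k (X v)).IsHomogeneous (coxWeight v 0) ∧
      HasHomogeneousCoeffs (coxEquiv k (X v)) (coxWeight v 1) := by
    rintro ⟨i, j⟩
    fin_cases i
    · simp only [Fin.zero_eta, coxEquiv_X_zero, coxWeight, Pi.single_eq_same]
      refine ⟨isHomogeneous_X _ _, fun e => ?_⟩
      rw [coeff_X]
      split_ifs
      exacts [isHomogeneous_one _ _, isHomogeneous_zero _ _ _]
    · simp only [Fin.mk_one, coxEquiv_X_one, coxWeight, Pi.single_eq_same]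
      refine ⟨isHomogeneous_C _ _, fun e => ?_⟩
      rw [coeff_C]
      split_ifs
      exacts [isHomogeneous_X _ _, isHomogeneous_zero _ _ _]
  have hXp : ∀ (v : Fin 2 × Fin 2) (n : ℕ),
      (coxEquiv k (X v ^ n)).IsHomogeneous (n * coxWeight v 0) ∧
        HasHomogeneousCoeffs (coxEquiv k (X v ^ n)) (n * coxWeight v 1) := by
    intro v n
    induction n with
    | zero =>
      simp only [pow_zero, map_one, zero_mul]
      exact ⟨isHomogeneous_one _ _, by simpa using hC 1⟩
    | succ n ih =>
      rw [pow_succ, map_mul, add_mul, add_mul, one_mul, one_mul]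
      exact ⟨ih.1.mul (hX v).1, ih.2.mul (hX v).2⟩
  induction m using Finsupp.induction_linear generalizing r with
  | zero =>
    rw [map_zero, monomial_zero', coxEquiv_C]
    exact ⟨isHomogeneous_C _ _, hC r⟩
  | add m₁ m₂ h₁ h₂ =>
    rw [← mul_one r, ← monomial_mul, map_mul, map_add]
    exact ⟨(h₁ r).1.mul (h₂ 1).1, (h₁ r).2.mul (h₂ 1).2⟩
  | single v n =>
    rw [← C_mul_X_pow_eq_monomial, map_mul, coxEquiv_C, Finsupp.weight_single]
    simp only [Pi.smul_apply, smul_eq_mul]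
    refine ⟨?_, ?_⟩
    · simpa using (isHomogeneous_C (Fin 2) (C r : MvPolynomial (Fin 2) k)).mul (hXp v n).1
    · simpa using (hC r).mul (hXp v n).2

lemma isHomogeneous_coxEquiv {f : CoxRing k} {d : Fin 2 → ℕ} (hf : f ∈ coxGrading k d) :
    (coxEquiv k f).IsHomogeneous (d 0) ∧ HasHomogeneousCoeffs (coxEquiv k f) (d 1) := by
  rw [mem_weightedHomogeneousSubmodule] at hf
  have h : ∀ m ∈ f.support, (coxEquiv k (monomial m (coeff m f))).IsHomogeneous (d 0) ∧
      HasHomogeneousCoeffs (coxEquiv k (monomial m (coeff m f))) (d 1) := by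
    intro m hm
    have := isHomogeneous_coxEquiv_monomial m (coeff m f)
    rwa [hf (mem_support_iff.1 hm)] at this
  rw [f.as_sum, map_sum]
  refine ⟨IsHomogeneous.sum _ _ _ fun m hm => (h m hm).1, fun e => ?_⟩
  rw [coeff_sum]
  exact IsHomogeneous.sum _ _ _ fun m hm => (h m hm).2 e

lemma isSumOf_comap_coxEquiv_symm {I : Ideal (CoxRing k)} (hI : I.IsHomogeneous (coxGrading k)) :
    IsSumOf (I.comap (coxEquiv k).symm)
      fun g => ∃ i d, g.IsHomogeneous i ∧ HasHomogeneousCoeffs g d := by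
  classical
  intro f hf
  rw [← (coxEquiv k).apply_symm_apply f,
    ← DirectSum.sum_support_decompose (coxGrading k) ((coxEquiv k).symm f), map_sum]
  refine AddSubmonoid.sum_mem _ fun d _ => AddSubmonoid.subset_closure ⟨?_, _, _,
    isHomogeneous_coxEquiv (SetLike.coe_mem _)⟩
  rw [Ideal.mem_comap, AlgEquiv.symm_apply_apply]
  exact hI d hf

/-- The irrelevant ideal of a factor. -/
lemma map_coxEquiv_span :
    (Ideal.span {X (0, 0), X (0, 1)} : Ideal (CoxRing k)).map (coxEquiv k) =
      idealOfVars (Fin 2) (MvPolynomial (Fin 2) k) := by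
  rw [Ideal.map_span, Set.image_pair]
  rw [coxEquiv_X_zero, coxEquiv_X_zero, idealOfVars]
  congr 1
  ext
  simp [eq_comm]

lemma idealOfVars_isPrime {σ R : Type*} [CommRing R] [IsDomain R] :
    (idealOfVars σ R).IsPrime := by
  have : idealOfVars σ R = RingHom.ker (constantCoeff : MvPolynomial σ R →+* R) := by
    ext f
    rw [← pow_one (idealOfVars σ R), mem_pow_idealOfVars_iff', RingHom.mem_ker,
      constantCoeff_eq]
    simp [Finsupp.degree_eq_zero_iff]
  rw [this]
  exact RingHom.ker_isPrime _

lemma isPrime_span_X_zero :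
    (Ideal.span {X (0, 0), X (0, 1)} : Ideal (CoxRing k)).IsPrime := by
  have h : (Ideal.span {X (0, 0), X (0, 1)} : Ideal (CoxRing k)) =
      (idealOfVars (Fin 2) (MvPolynomial (Fin 2) k)).comap (coxEquiv k) := by
    rw [← map_coxEquiv_span, Ideal.comap_map_of_bijective _ (coxEquiv k).bijective]
  rw [h]
  have := idealOfVars_isPrime (σ := Fin 2) (R := MvPolynomial (Fin 2) k)
  exact Ideal.IsPrime.comap _

lemma maximalMinorsIdeal_map {R S : Type*} [CommRing R] [CommRing S] (φ : R →+* S) {m : ℕ}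
    (M : Matrix (Fin (m + 1)) (Fin m) R) :
    maximalMinorsIdeal (M.map φ) = (maximalMinorsIdeal M).map φ := by
  rw [maximalMinorsIdeal, maximalMinorsIdeal, Ideal.map_span, ← Set.range_comp]
  congr 2
  ext i
  rw [Function.comp_apply, RingHom.map_det]
  rfl

/-- A saturated bihomogeneous ideal that contains a nonzero form in either set of variables has
truncations that are generated by maximal minors, with Cohen–Macaulay quotient. -/
theorem exists_maximalMinorsIdeal_eq_inf_pow {I : Ideal (CoxRing k)}
    (hI : I.IsHomogeneous (coxGrading k))
    (hsat : ∀ (i : Fin 2) (z : CoxRing k), X (i, 0) * z ∈ I → X (i, 1) * z ∈ I → z ∈ I)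
    (hform : ∀ i : Fin 2, ∃ F : MvPolynomial (Fin 2) k, F ≠ 0 ∧
      rename (fun l => (i, l)) F ∈ I) :
    ∃ (n m : ℕ) (M : Matrix (Fin (m + 1)) (Fin m) (CoxRing k)),
      maximalMinorsIdeal M = I ⊓ Ideal.span {X (0, 0), X (0, 1)} ^ (n + 1) ∧
      IsCohenMacaulay (CoxRing k ⧸ maximalMinorsIdeal M) := by
  obtain ⟨F, hF, hFI⟩ := hform 0
  obtain ⟨G, hG, hGI⟩ := hform 1
  let e := coxEquiv k
  obtain ⟨n, M, hM, hp⟩ := (isSumOf_comap_coxEquiv_symm hI).exists_maximalMinorsIdeal_eq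
    (fun z h0 h1 => hsat 0 _ (by simpa [coxEquiv_symm_X] using h0)
      (by simpa [coxEquiv_symm_X] using h1))
    (fun z h0 h1 => hsat 1 _ (by simpa [coxEquiv_symm_C_X] using h0)
      (by simpa [coxEquiv_symm_C_X] using h1)) hG
    (by rwa [← coxEquiv_rename_one, Ideal.mem_comap, AlgEquiv.symm_apply_apply]) hF
    (by rwa [← coxEquiv_rename_zero, Ideal.mem_comap, AlgEquiv.symm_apply_apply])
  let φ : MvPolynomial (Fin 2) (MvPolynomial (Fin 2) k) →+* CoxRing k :=
    RingHomClass.toRingHom e.symm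
  have hφ : Function.Surjective φ := e.symm.surjective
  let M' := M.map φ
  have hM' : maximalMinorsIdeal M' = (maximalMinorsIdeal M).map φ := maximalMinorsIdeal_map φ M
  have hmem : ∀ x, x ∈ maximalMinorsIdeal M' ↔ e x ∈ maximalMinorsIdeal M := by
    intro x
    rw [hM', Ideal.mem_map_iff_of_surjective φ hφ]
    refine ⟨?_, fun h => ⟨_, h, e.symm_apply_apply x⟩⟩
    rintro ⟨y, hy, rfl⟩
    exact (e.apply_symm_apply y).symm ▸ hy
  have hQ : ∀ x, x ∈ (Ideal.span {X (0, 0), X (0, 1)} : Ideal (CoxRing k)) ^ (n + 1) ↔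
      e x ∈ idealOfVars (Fin 2) (MvPolynomial (Fin 2) k) ^ (n + 1) := by
    intro x
    rw [← map_coxEquiv_span, ← Ideal.map_pow,
      Ideal.mem_map_iff_of_surjective _ e.surjective]
    refine ⟨fun h => ⟨_, h, rfl⟩, ?_⟩
    rintro ⟨y, hy, hyx⟩
    exact e.injective hyx ▸ hy
  have hp' : ∀ p, Prime p → ∃ i, ¬ p ∣ signedMinor M' i := by
    intro p hpp
    obtain ⟨x, hx, hpx⟩ := hp (e p) ((MulEquiv.prime_iff e).2 hpp)
    by_contra! hall
    have hle : maximalMinorsIdeal M' ≤ Ideal.span {p} := by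
      rw [← span_range_signedMinor, Ideal.span_le]
      rintro _ ⟨i, rfl⟩
      exact Ideal.mem_span_singleton.2 (hall i)
    have h1 := Ideal.mem_span_singleton.1 (hle ((hmem (e.symm x)).2 (by simpa using hx)))
    have h2 := map_dvd e h1
    rw [AlgEquiv.apply_symm_apply] at h2
    exact hpx h2
  -- Any prime would do: a minor that it does not divide is nonzero.
  obtain ⟨i, hi⟩ := hp' (X (0, 0)) X_prime
  refine ⟨n, _, M', ?_, isCohenMacaulay_quotient_maximalMinorsIdeal (by simp) hp'
    (i := i) fun h => hi (h ▸ dvd_zero _)⟩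
  ext x
  rw [hmem, hM, Ideal.mem_inf, Ideal.mem_inf, hQ, Ideal.mem_comap, AlgEquiv.symm_apply_apply]

end CoxRing

/-! ### Forms vanishing on a zero-dimensional subscheme -/

section VanishingForms

variable {k : Type u} [Field k]

/-- The homogenization of a polynomial with respect to the variables `X l` and `X c`. -/
def binaryForm (p : Polynomial k) (c l : Fin 2) : MvPolynomial (Fin 2) k :=
  ∑ j ∈ Finset.range (p.natDegree + 1),
    MvPolynomial.C (p.coeff j) * MvPolynomial.X l ^ j * MvPolynomial.X c ^ (p.natDegree - j)

lemma binaryForm_ne_zero {p : Polynomial k} (hp : p ≠ 0) {c l : Fin 2} (hcl : c ≠ l) :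
    binaryForm p c l ≠ 0 := by
  intro h
  apply hp
  -- Setting the other variable to `1` recovers `p`.
  have h1 := congrArg (MvPolynomial.aeval fun m => if m = l then (Polynomial.X : Polynomial k)
    else 1) h
  rw [map_zero, binaryForm, map_sum] at h1
  rw [← h1]
  conv_lhs => rw [p.as_sum_range_C_mul_X_pow]
  refine Finset.sum_congr rfl fun j _ => ?_
  simp [hcl]

lemma isHomogeneousElem_rename_binaryForm (p : Polynomial k) (c l i : Fin 2) :
    SetLike.IsHomogeneousElem (coxGrading k)
      (MvPolynomial.rename (fun m => (i, m)) (binaryForm p c l)) := by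
  refine ⟨p.natDegree • Pi.single i 1, ?_⟩
  rw [binaryForm, map_sum]
  refine Submodule.sum_mem _ fun j hj => ?_
  have hX : ∀ m : Fin 2, MvPolynomial.IsWeightedHomogeneous coxWeight
      (MvPolynomial.X (i, m) : CoxRing k) (Pi.single i 1) :=
    fun m => MvPolynomial.isWeightedHomogeneous_X k coxWeight (i, m)
  have := ((MvPolynomial.isWeightedHomogeneous_C coxWeight (p.coeff j)).mul
    ((hX l).pow j)).mul ((hX c).pow (p.natDegree - j))
  rw [zero_add, ← add_nsmul, Nat.add_sub_cancel' (by simpa [Nat.lt_succ_iff] using hj)] at this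
  simpa using this

lemma dehomogenize_rename_binaryForm (p : Polynomial k) (c : Fin 2 → Fin 2) (i l : Fin 2) :
    dehomogenize k c (MvPolynomial.rename (fun m => (i, m)) (binaryForm p (c i) l)) =
      p.eval₂ (biProjConst k c) (biProjCoord k c i l) := by
  have hX : biProjCoord k c i (c i) = 1 := by
    rw [← dehomogenize_X_self k c i, dehomogenize, MvPolynomial.coe_eval₂Hom,
      MvPolynomial.eval₂_X]
  rw [binaryForm, map_sum, map_sum, Polynomial.eval₂_eq_sum_range]
  refine Finset.sum_congr rfl fun j _ => ?_
  simp [dehomogenize, hX]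

/-- A zero-dimensional subscheme is contained in the zero locus of a nonzero form in the
coordinates of a given factor. -/
lemma exists_rename_mem_subschemeIdeal {Z : Scheme.{u}} (ι : Z ⟶ biProj k) [IsClosedImmersion ι]
    (hZ : topologicalKrullDim Z ≤ 0) (i : Fin 2) :
    ∃ F : MvPolynomial (Fin 2) k, F ≠ 0 ∧
      MvPolynomial.rename (fun l => (i, l)) F ∈ subschemeIdeal ι := by
  -- In `Fin 2`, `c i + 1` is the other index. On each chart the affine coordinate satisfies a monic
  -- equation over `k`; the product of the homogenized equations vanishes on all charts.
  choose p hp hpc using fun c : Fin 2 → Fin 2 => isIntegralElem_subschemeConst ι hZ c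
    ((ι.app (biProjOpen k c)).hom (biProjCoord k c i (c i + 1)))
  have hne : ∀ a : Fin 2, a ≠ a + 1 := by decide
  refine ⟨∏ c, binaryForm (p c) (c i) (c i + 1), Finset.prod_ne_zero_iff.2 fun c _ =>
    binaryForm_ne_zero (hp c).ne_zero (hne _), Ideal.subset_span ⟨?_, fun c => ?_⟩⟩
  · rw [map_prod]
    exact Submonoid.prod_mem (SetLike.homogeneousSubmonoid (coxGrading k))
      fun c _ => isHomogeneousElem_rename_binaryForm _ _ _ _
  · rw [map_prod, map_prod, map_prod]
    refine Finset.prod_eq_zero (Finset.mem_univ c) ?_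
    rw [dehomogenize_rename_binaryForm, Polynomial.hom_eval₂]
    exact hpc c

/-- The irrelevant ideal is contained in `⟨x_{i,0}, x_{i,1}⟩`, so saturation with respect to it is
the stronger property. -/
lemma mem_subschemeIdeal_of_X_mul_mem {Z : Scheme.{u}} (ι : Z ⟶ biProj k) (i : Fin 2)
    (z : CoxRing k) (h0 : MvPolynomial.X (i, 0) * z ∈ subschemeIdeal ι)
    (h1 : MvPolynomial.X (i, 1) * z ∈ subschemeIdeal ι) : z ∈ subschemeIdeal ι := by
  refine subschemeIdeal_saturated ι 1 z fun b hb => ?_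
  rw [pow_one, irrelevantIdeal, Ideal.mem_iInf] at hb
  obtain ⟨u, v, rfl⟩ := Ideal.mem_span_pair.1 (hb i)
  have : z * (u * MvPolynomial.X (i, 0) + v * MvPolynomial.X (i, 1)) =
      u * (MvPolynomial.X (i, 0) * z) + v * (MvPolynomial.X (i, 1) * z) := by ring
  rw [this]
  exact Ideal.add_mem _ (Ideal.mul_mem_left _ _ h0) (Ideal.mul_mem_left _ _ h1)

end VanishingForms

end

theorem corollary5p2 {k : Type u} [Field k] {Z : Scheme.{u}} (ι : Z ⟶ biProj k)
    [IsClosedImmersion ι] (hZ : topologicalKrullDim Z = 0) :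
    ∃ Q : Ideal (CoxRing k),
      Q.IsHomogeneous (coxGrading k) ∧
      Q.radical = Ideal.span {MvPolynomial.X (0, 0), MvPolynomial.X (0, 1)} ∧
      IsCohenMacaulay (CoxRing k ⧸ (subschemeIdeal ι ⊓ Q)) ∧
      ∃ (m : ℕ) (A : Matrix (Fin (m + 1)) (Fin m) (CoxRing k)),
        maximalMinorsIdeal A = subschemeIdeal ι ⊓ Q := by
  classical
  obtain ⟨n, m, A, hA, hCM⟩ := exists_maximalMinorsIdeal_eq_inf_pow (I := subschemeIdeal ι)
    (Ideal.homogeneous_span _ _ fun x hx => hx.1)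
    (mem_subschemeIdeal_of_X_mul_mem ι) (exists_rename_mem_subschemeIdeal ι hZ.le)
  have hP : (Ideal.span {MvPolynomial.X (0, 0), MvPolynomial.X (0, 1)} :
      Ideal (CoxRing k)).IsHomogeneous (coxGrading k) := by
    refine Ideal.homogeneous_span _ _ ?_
    rintro _ (rfl | rfl) <;>
    exact ⟨_, MvPolynomial.isWeightedHomogeneous_X k coxWeight _⟩
  refine ⟨Ideal.span {MvPolynomial.X (0, 0), MvPolynomial.X (0, 1)} ^ (n + 1), ?_, ?_,
    hA ▸ hCM, m, A, hA⟩
  · clear hA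
    induction n with
    | zero => simpa using hP
    | succ n ih =>
      rw [pow_succ]
      exact ih.mul hP
  -- The exponent is positive and the ideal of the two variables is prime.
  · rw [Ideal.radical_pow _ n.succ_ne_zero]
    exact isPrime_span_X_zero.radical
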